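/- **Setting.** Consider qCCS process terms over countably many classical (real-valued) variables and countably many qubit variables $qVar$, $$t ::= \mathbf{nil}\mid A(\tilde e,\tilde q)\mid \alpha.t\mid t+t\mid t\|t\mid t\backslash L\mid t[f]\mid \mathbf{if}\ b\ \mathbf{then}\ t,\qquad \alpha ::= \tau\mid c?x\mid c!e\mid \mathsf c?q\mid \mathsf c!q\mid \mathcal F[\tilde q]\mid M[\tilde q;x],$$ taken up to $\alpha$-conversion, where $\mathcal F$ is a trace-preserving super-operator and $M$ a non-degenerate projective measurement on the qubits $\tilde q$ (a tuple of distinct variables), $q\notin qv(t)$ in $\mathsf c!q.t$, $qv(t)\cap qv(u)=\emptyset$ in $t\|u$, and every process constant has a defining equation $A(\tilde x,\tilde q)\stackrel{def}{=}t_A$ with $fv(t_A)\subseteq\tilde x$, $qv(t_A)\subseteq\tilde q$. Here $fv$ and $qv$ denote the sets of free classical and free quantum variables. Let $\mathcal H=\bigotimes_{q\in qVar}\mathcal H_q$ be the (separable) state space of all qubits, $CP(\mathcal H)$ the semiring of completely positive super-operators, with composition as product, and $CP_t(\mathcal H)$ the trace-preserving ones; for $V\subseteq qVar$, $CP_t(\mathcal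 H_V)$ is identified with the set of the $\mathcal G\otimes\mathcal I\in CP_t(\mathcal H)$ where $\mathcal G$ is trace preserving on $\mathcal H_V$. Write $\overline V=qVar\setminus V$, and $\mathcal A\eqsim_V\mathcal B$ if $\mathrm{tr}_{\overline V}\mathcal A(\rho)=\mathrm{tr}_{\overline V}\mathcal B(\rho)$ for all density operators $\rho$ on $\mathcal H$; $\eqsim$ is $\eqsim_\emptyset$ (equality of traces). A *snapshot* is a pair $\langle t,\mathcal E\rangle$ of a term and $\mathcal E\in CP_t(\mathcal H)$; $SN$ is the set of snapshots. A *distribution* $\Delta$ is a function of finite support $SN\to CP(\mathcal H)$ with $\sum_{s}\Delta(s)\eqsim\mathcal I_{\mathcal H}$; for $\mathcal E\in CP_t(\mathcal H)$ put $(\mathcal E\bullet\Delta)(s)=\Delta(s)\mathcal E$; a snapshot $s$ stands for the distribution that is $\mathcal I_{\mathcal H}$ at $s$ and $0$ elsewhere. The symbolic transitions $\langle t,\mathcal E\rangle\xrightarrow{b,\gamma}\Delta$, with $b$ a boolean expression and $\gamma\in\{\tau,c?x,c!e,\mathsf c?r,\mathsf c!r\}$, form the smallest relation such that (with terms up to $\alpha$-conversion)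 * $\langle\gamma.t,\mathcal E\rangle\xrightarrow{\mathrm{true},\gamma}\langle t,\mathcal E\rangle$; $\ \langle\mathcal F[\tilde q].t,\mathcal E\rangle\xrightarrow{\mathrm{true},\tau}\langle t,\mathcal F_{\tilde q}\mathcal E\rangle$; and, if $M=\sum_i\lambda_i|\phi_i\rangle\langle\phi_i|$, $\ \langle M[\tilde q;x].t,\mathcal E\rangle\xrightarrow{\mathrm{true},\tau}\sum_i\mathcal A_i\bullet\langle t\{\lambda_i/x\},Set_i\,\mathcal E\rangle$, where on the qubits $\tilde q$ $\mathcal A_i$ has the Kraus operator $|\phi_i\rangle\langle\phi_i|$ and $Set_i$ has the Kraus operators $|\phi_i\rangle\langle\phi_j|$ for all $j$; * a move $\xrightarrow{b,\gamma}\Delta$ of $t$ gives the moves $\xrightarrow{b,\gamma}\Delta$ of $t+u$ and $u+t$; $\xrightarrow{b,\gamma}\Delta\|u$ of $t\|u$ (symmetrically for $u\|t$) if the variable bound by $\gamma$ (the $x$ of $c?x$, the $r$ of $\mathsf c?r$), if any, is not free in $u$; $\xrightarrow{b,\gamma}\Delta\backslash L$ of $t\backslash L$ if the channel of $\gamma$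 is not in $L$; $\xrightarrow{b,f(\gamma)}\Delta[f]$ of $t[f]$; $\xrightarrow{b_0\wedge b,\gamma}\Delta$ of $\mathbf{if}\ b_0\ \mathbf{then}\ t$; * if $\langle t,\mathcal E\rangle\xrightarrow{b_1,c?x}\langle t',\mathcal E\rangle$ and $\langle u,\mathcal E\rangle\xrightarrow{b_2,c!e}\langle u',\mathcal E\rangle$ then $\langle t\|u,\mathcal E\rangle\xrightarrow{b_1\wedge b_2,\tau}\langle t'\{e/x\}\|u',\mathcal E\rangle$; if the labels are $\mathsf c?r$ and $\mathsf c!r$ then $\langle t\|u,\mathcal E\rangle\xrightarrow{b_1\wedge b_2,\tau}\langle t'\|u',\mathcal E\rangle$; and symmetrically; * $A(\tilde e,\tilde r)$ has the moves of $t_A\{\tilde e/\tilde x,\tilde r/\tilde q\}$. For boolean expressions, $b\to b'$ means that every evaluation of the classical variables that satisfies $b$ satisfies $b'$. Write $\gamma=_b\gamma'$ if $\gamma=c!e$, $\gamma'=c!e'$ and $b\to e=e'$, or if $\gamma=\gamma'$ is not a classical output. $bv(\gamma)$ is $\{x\}$ for $\gamma=c?x$ and empty otherwise. For an equivalence relation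 $\mathcal S$ on $SN$ write $\Delta\,\mathcal S\,\Xi$ if $\sum_{s\in T}\Delta(s)\eqsim\sum_{s\in T}\Xi(s)$ for every equivalence class $T$ of $\mathcal S$. For a family $(\mathcal S^b)$ of equivalence relations on $SN$, indexed by the boolean expressions, and snapshots $\langle t,\mathcal E\rangle$, $\langle u,\mathcal F\rangle$, consider the conditions 1. if $b$ is satisfiable, then $qv(t)=qv(u)$ and $\mathcal E\eqsim_{\overline{qv(t)}}\mathcal F$; 2. for every $\mathcal G\in CP_t(\mathcal H_{\overline{qv(t)}})$, whenever $\langle t,\mathcal G\mathcal E\rangle\xrightarrow{b_1,\gamma}\Delta$ with $bv(\gamma)\cap fv(b,t,u)=\emptyset$, there is a finite set $B$ of boolean expressions with $b\wedge b_1\to\bigvee B$ such that for each $b'\in B$ there are $b_2,\gamma',\Xi$ with $b'\to b_2$, $\gamma=_{b'}\gamma'$, $\langle u,\mathcal G\mathcal F\rangle\xrightarrow{b_2,\gamma'}\Xi$ and $(\mathcal G\mathcal E\bullet\Delta)\,\mathcal S^{b'}\,(\mathcal G\mathcal F\bullet\Xi)$. The family is a *symbolic bisimulation* if for every $b$, $\langle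 t,\mathcal E\rangle\,\mathcal S^b\,\langle u,\mathcal F\rangle$ implies (1) and (2). Write $\langle t,\mathcal E\rangle\sim^b\langle u,\mathcal F\rangle$ if $\langle t,\mathcal E\rangle\,\mathcal S^b\,\langle u,\mathcal F\rangle$ for some symbolic bisimulation $(\mathcal S^b)$ (it is known that each $\sim^b$ is an equivalence relation). **Theorem.** Let $\langle t,\mathcal E\rangle,\langle u,\mathcal F\rangle$ be snapshots and $b$ a boolean expression. Then $\langle t,\mathcal E\rangle\sim^b\langle u,\mathcal F\rangle$ if and only if all of the following hold: 1. if $b$ is satisfiable, then $qv(t)=qv(u)$ and $\mathcal E\eqsim_{\overline{qv(t)}}\mathcal F$; 2. for every $\mathcal G\in CP_t(\mathcal H_{\overline{qv(t)}})$, whenever $\langle t,\mathcal G\mathcal E\rangle\xrightarrow{b_1,\gamma}\Delta$ with $bv(\gamma)\cap fv(b,t,u)=\emptyset$, there is a finite set $B$ of boolean expressions with $b\wedge b_1\to\bigvee B$ such that for each $b'\in B$ there are $b_2,\gamma',\Xi$ with $b'\to b_2$, $\gamma=_{b'}\gamma'$, $\langle u,\mathcal G\mathcal F\rangle\xrightarrow{b_2,\gamma'}\Xi$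 and $(\mathcal G\mathcal E\bullet\Delta)\sim^{b'}(\mathcal G\mathcal F\bullet\Xi)$; 3. the symmetric condition of (2), with $\langle t,\mathcal E\rangle$ and $\langle u,\mathcal F\rangle$ interchanged. -/

import Mathlib

namespace QCCS

noncomputable section

open scoped InnerProductSpace ComplexOrder

/-! ## Hilbert spaces of families of qubits -/

/-- The state space of the qubits indexed by `ι`: the tensor product of the two-dimensional spaces
`ℂ²` with orthonormal basis the computational basis states `|s⟩`, where `s` is the finite set of
the qubits that are in state `|1⟩` (all the others are in state `|0⟩`). -/
abbrev Hil (ι : Type) : Type := lp (fun _ : Finset ι => ℂ) 2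

/-- Bounded operators on the state space. -/
abbrev Op (ι : Type) : Type := Hil ι →L[ℂ] Hil ι

open Classical in
/-- The computational basis state `|s⟩`. -/
def ket {ι : Type} (s : Finset ι) : Hil ι := lp.single 2 s (1 : ℂ)

theorem inner_ket {ι : Type} (s : Finset ι) (v : Hil ι) : ⟪ket s, v⟫_ℂ = v s := by
  classical
  simp only [ket]
  rw [lp.inner_single_left]
  simp

theorem inner_ket_right {ι : Type} (s : Finset ι) (v : Hil ι) :
    ⟪v, ket s⟫_ℂ = (starRingEnd ℂ) (v s) := by
  rw [← inner_conj_symm, inner_ket]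

theorem ket_apply {ι : Type} [DecidableEq (Finset ι)] (s t : Finset ι) :
    (ket s : Hil ι) t = if t = s then 1 else 0 := by
  classical
  simp only [ket, lp.single_apply]
  by_cases h : t = s
  · subst h; simp
  · simp [h]

theorem hasSum_ket {ι : Type} (v : Hil ι) : HasSum (fun s => v s • ket s) v := by
  classical
  have h := lp.hasSum_single (p := 2) (by simp) v
  convert! h using 2 with s
  rw [ket, ← lp.single_smul, smul_eq_mul, mul_one]

/-- The partial isometry `|φ x⟩ ↦ |x⟩`. -/
def restrict {κ ι : Type} (φ : Finset κ → Finset ι) (hφ : Function.Injective φ) :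
    Hil ι →L[ℂ] Hil κ :=
  LinearMap.mkContinuous
    { toFun := fun v => ⟨fun x => v (φ x), by
        have h := (lp.memℓp v).summable (by norm_num)
        refine memℓp_gen ?_
        exact h.comp_injective hφ⟩
      map_add' := fun _ _ => rfl
      map_smul' := fun _ _ => rfl } 1 (by
    intro v
    rw [one_mul]
    refine lp.norm_le_of_forall_sum_le (by norm_num) (norm_nonneg _) (fun s => ?_)
    have h := lp.sum_rpow_le_norm_rpow (p := 2) (by norm_num) v (s.map ⟨φ, hφ⟩)
    refine le_trans (le_of_eq ?_) h
    rw [Finset.sum_map]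
    rfl)

theorem restrict_apply {κ ι : Type} (φ : Finset κ → Finset ι) (hφ : Function.Injective φ)
    (v : Hil ι) (x : Finset κ) : restrict φ hφ v x = v (φ x) := rfl

theorem restrict_adjoint_ket {κ ι : Type} (φ : Finset κ → Finset ι) (hφ : Function.Injective φ)
    (x : Finset κ) : (restrict φ hφ).adjoint (ket x) = ket (φ x) := by
  refine ext_inner_right ℂ fun v => ?_
  rw [ContinuousLinearMap.adjoint_inner_left, inner_ket, inner_ket, restrict_apply]

/-! ## Trace-class operators -/

/-- `A` is nuclear, i.e. trace class: `A = ∑ₙ |vₙ⟩⟨wₙ|` with `∑ₙ ‖vₙ‖ ‖wₙ‖ < ∞`. -/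
def IsTraceClass {ι : Type} (A : Op ι) : Prop :=
  ∃ v w : ℕ → Hil ι, Summable (fun n => ‖v n‖ * ‖w n‖) ∧
    ∀ x, HasSum (fun n => ⟪w n, x⟫_ℂ • v n) (A x)

theorem IsTraceClass.of_countable {ι I : Type} [Countable I] {A : Op ι} (v w : I → Hil ι)
    (hs : Summable (fun n => ‖v n‖ * ‖w n‖))
    (hA : ∀ x, HasSum (fun n => ⟪w n, x⟫_ℂ • v n) (A x)) : IsTraceClass A := by
  obtain ⟨e, he⟩ := exists_injective_nat I
  refine ⟨Function.extend e v 0, Function.extend e w 0, ?_, fun x => ?_⟩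
  · rw [← he.summable_iff]
    · convert! hs using 2 with n
      simp [he.extend_apply]
    · intro n hn
      rw [Function.extend_apply' _ _ _ (by simpa using hn)]
      simp
  · rw [← he.hasSum_iff]
    · convert! hA x using 2 with n
      simp [he.extend_apply]
    · intro n hn
      rw [Function.extend_apply' _ _ _ (by simpa using hn)]
      simp

/-- The trace-class operators on the state space. -/
def TraceClass (ι : Type) : Submodule ℂ (Op ι) where
  carrier := {A | IsTraceClass A}
  zero_mem' := ⟨0, 0, by simp, fun x => by simp⟩
  add_mem' := by
    rintro A B ⟨v, w, hs, hA⟩ ⟨v', w', hs', hB⟩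
    refine IsTraceClass.of_countable (I := ℕ ⊕ ℕ) (Sum.elim v v') (Sum.elim w w') ?_ fun x => ?_
    · exact Summable.sum _ (by simpa [Function.comp_def] using hs)
        (by simpa [Function.comp_def] using hs')
    · exact HasSum.sum (f := fun n : ℕ ⊕ ℕ => ⟪Sum.elim w w' n, x⟫_ℂ • Sum.elim v v' n) (hA x) (hB x)
  smul_mem' := by
    rintro c A ⟨v, w, hs, hA⟩
    refine ⟨fun n => c • v n, w, ?_, fun x => ?_⟩
    · simpa [norm_smul, mul_assoc] using hs.mul_left ‖c‖
    · have h := (hA x).const_smul c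
      simp only [smul_comm c] at h
      exact h

theorem IsTraceClass.conj {κ ι : Type} {A : Op ι} (hA : IsTraceClass A) (X : Hil ι →L[ℂ] Hil κ)
    (Y : Hil κ →L[ℂ] Hil ι) : IsTraceClass (X ∘L A ∘L Y) := by
  obtain ⟨v, w, hs, hA⟩ := hA
  refine ⟨fun n => X (v n), fun n => Y.adjoint (w n), ?_, fun x => ?_⟩
  · refine Summable.of_nonneg_of_le (fun n => by positivity) (fun n => ?_)
      (hs.mul_left (‖X‖ * ‖Y.adjoint‖))
    calc ‖X (v n)‖ * ‖Y.adjoint (w n)‖ ≤ (‖X‖ * ‖v n‖) * (‖Y.adjoint‖ * ‖w n‖) := by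
          gcongr
          · exact X.le_opNorm _
          · exact Y.adjoint.le_opNorm _
      _ = _ := by ring
  · have h := (hA (Y x)).mapL X
    simpa [ContinuousLinearMap.adjoint_inner_left] using h

/-- `A ↦ X A Y` on trace-class operators. -/
def sandwich {κ ι : Type} (X : Hil ι →L[ℂ] Hil κ) (Y : Hil κ →L[ℂ] Hil ι) :
    TraceClass ι →ₗ[ℂ] TraceClass κ where
  toFun A := ⟨X ∘L A.1 ∘L Y, IsTraceClass.conj A.2 X Y⟩
  map_add' A B := by ext1; simp
  map_smul' c A := by ext1; simp

/-- The trace of a (trace-class) operator. -/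
def tr {ι : Type} (A : Op ι) : ℂ := ∑' s, ⟪ket s, A (ket s)⟫_ℂ

theorem summable_mul {ι : Type} (v w : Hil ι) : Summable (fun s => ‖w s‖ * ‖v s‖) ∧
    ∑' s, ‖w s‖ * ‖v s‖ ≤ ‖w‖ * ‖v‖ := by
  have h2 : Real.HolderConjugate 2 2 := Real.HolderConjugate.two_two
  have h := Real.summable_and_inner_le_Lp_mul_Lq_tsum_of_nonneg h2 (f := fun s => ‖w s‖)
    (g := fun s => ‖v s‖) (fun _ => norm_nonneg _) (fun _ => norm_nonneg _)
    (by simpa using (lp.memℓp w).summable (by norm_num))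
    (by simpa using (lp.memℓp v).summable (by norm_num))
  refine ⟨h.1, h.2.trans (le_of_eq ?_)⟩
  rw [lp.norm_eq_tsum_rpow (by norm_num) w, lp.norm_eq_tsum_rpow (by norm_num) v]
  simp

theorem hasSum_tr {ι : Type} {A : Op ι} {v w : ℕ → Hil ι}
    (hs : Summable (fun n => ‖v n‖ * ‖w n‖))
    (hA : ∀ x, HasSum (fun n => ⟪w n, x⟫_ℂ • v n) (A x)) :
    HasSum (fun s => ⟪ket s, A (ket s)⟫_ℂ) (∑' n, ⟪w n, v n⟫_ℂ) := by
  have hsum : Summable (fun p : ℕ × Finset ι => ⟪w p.1 p.2, v p.1 p.2⟫_ℂ) := by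
    refine Summable.of_norm ?_
    refine (summable_prod_of_nonneg (fun _ => norm_nonneg _)).2 ⟨fun n => ?_, ?_⟩
    · simpa [mul_comm] using (summable_mul (v n) (w n)).1
    · refine Summable.of_nonneg_of_le (fun n => tsum_nonneg fun _ => norm_nonneg _) (fun n => ?_) hs
      have := (summable_mul (w n) (v n)).2
      simpa using this
  have h1 : HasSum (fun p : ℕ × Finset ι => ⟪w p.1 p.2, v p.1 p.2⟫_ℂ) (∑' n, ⟪w n, v n⟫_ℂ) := by
    have h := hsum.hasSum
    rw [← (h.prod_fiberwise fun n => lp.hasSum_inner (w n) (v n)).tsum_eq] at h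
    exact h
  have h2 := ((Equiv.prodComm _ _).hasSum_iff.2 h1 : HasSum (_ ∘ (Equiv.prodComm (Finset ι) ℕ)) _)
  refine h2.prod_fiberwise fun s => ?_
  have h3 := (hA (ket s)).mapL (innerSL ℂ (ket s))
  simpa [inner_ket, inner_ket_right, mul_comm] using h3

theorem summable_tr {ι : Type} {A : Op ι} (hA : IsTraceClass A) :
    Summable (fun s => ⟪ket s, A (ket s)⟫_ℂ) := by
  obtain ⟨v, w, hs, hA⟩ := hA
  exact (hasSum_tr hs hA).summable

open Classical in
/-- For an injection `f : κ ↪ ι`, the basis state of the qubits `ι` that is `|x⟩` on the qubits in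
the range of `f` and `|z⟩` on the remaining qubits. -/
def glue {κ ι : Type} (f : κ ↪ ι) (x : Finset κ) (z : Finset ↥(Set.range f)ᶜ) : Finset ι :=
  x.map f ∪ z.map (Function.Embedding.subtype _)

theorem mem_glue {κ ι : Type} (f : κ ↪ ι) (x : Finset κ) (z : Finset ↥(Set.range f)ᶜ) (i : ι) :
    i ∈ glue f x z ↔ (∃ k ∈ x, f k = i) ∨ ∃ h : i ∈ (Set.range f)ᶜ, ⟨i, h⟩ ∈ z := by
  simp [glue]

theorem glue_apply_mem {κ ι : Type} (f : κ ↪ ι) (x : Finset κ) (z : Finset ↥(Set.range f)ᶜ) (k : κ) :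
    f k ∈ glue f x z ↔ k ∈ x := by
  simp [mem_glue]

theorem glue_compl_mem {κ ι : Type} (f : κ ↪ ι) (x : Finset κ) (z : Finset ↥(Set.range f)ᶜ)
    (i : ↥(Set.range f)ᶜ) : (i : ι) ∈ glue f x z ↔ i ∈ z := by
  rw [mem_glue]
  constructor
  · rintro (⟨k, _, hk⟩ | ⟨_, h⟩)
    · exact absurd ⟨k, hk⟩ i.2
    · exact h
  · exact fun h => Or.inr ⟨i.2, h⟩

theorem glue_bijective {κ ι : Type} (f : κ ↪ ι) :
    Function.Bijective (fun p : Finset ↥(Set.range f)ᶜ × Finset κ => glue f p.2 p.1) := by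
  classical
  constructor
  · rintro ⟨z, x⟩ ⟨z', x'⟩ h
    simp only at h
    refine Prod.ext ?_ ?_
    · ext i; rw [← glue_compl_mem f x z, h, glue_compl_mem]
    · ext k; rw [← glue_apply_mem f x z, h, glue_apply_mem]
  · intro s
    refine ⟨(s.subtype _, s.preimage f f.injective.injOn), ?_⟩
    ext i
    simp only [mem_glue, Finset.mem_preimage, Finset.mem_subtype]
    constructor
    · rintro (⟨k, hk, rfl⟩ | ⟨_, h⟩) <;> assumption
    · intro hi
      by_cases h : i ∈ Set.range f
      · obtain ⟨k, rfl⟩ := h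
        exact Or.inl ⟨k, hi, rfl⟩
      · exact Or.inr ⟨h, hi⟩

theorem glue_left_injective {κ ι : Type} (f : κ ↪ ι) (z : Finset ↥(Set.range f)ᶜ) :
    Function.Injective (fun x => glue f x z) := fun x x' h =>
  (Prod.ext_iff.1 ((glue_bijective f).1 (a₁ := (z, x)) (a₂ := (z, x')) h)).2

theorem glue_right_injective {κ ι : Type} (f : κ ↪ ι) (x : Finset κ) :
    Function.Injective (fun z => glue f x z) := fun z z' h =>
  (Prod.ext_iff.1 ((glue_bijective f).1 (a₁ := (z, x)) (a₂ := (z', x)) h)).1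

/-- The operator `⟨z| : H_ι → H_κ`, where `|z⟩` is a basis state of the qubits outside the range of
`f : κ ↪ ι`; it maps `|x⟩ ⊗ |z'⟩` to `⟨z|z'⟩ |x⟩`. -/
def bra {κ ι : Type} (f : κ ↪ ι) (z : Finset ↥(Set.range f)ᶜ) : Hil ι →L[ℂ] Hil κ :=
  restrict (fun x => glue f x z) (glue_left_injective f z)

/-- The operator `⟨z| A |w⟩` on `H_κ`, where `|z⟩`, `|w⟩` are basis states of the qubits outside
the range of `f : κ ↪ ι`. -/
def block {κ ι : Type} (f : κ ↪ ι) (z w : Finset ↥(Set.range f)ᶜ) :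
    TraceClass ι →ₗ[ℂ] TraceClass κ :=
  sandwich (bra f z) (bra f w).adjoint

theorem inner_block {κ ι : Type} (f : κ ↪ ι) (z w : Finset ↥(Set.range f)ᶜ) (A : TraceClass ι)
    (u v : Hil κ) : ⟪u, (block f z w A).1 v⟫_ℂ =
      ⟪(bra f z).adjoint u, A.1 ((bra f w).adjoint v)⟫_ℂ := by
  rw [ContinuousLinearMap.adjoint_inner_left]
  rfl

theorem inner_ket_block {κ ι : Type} (f : κ ↪ ι) (z w : Finset ↥(Set.range f)ᶜ) (A : TraceClass ι)
    (x y : Finset κ) : ⟪ket x, (block f z w A).1 (ket y)⟫_ℂ =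
      ⟪ket (glue f x z), A.1 (ket (glue f y w))⟫_ℂ := by
  simp only [block, sandwich, LinearMap.coe_mk, AddHom.coe_mk, ContinuousLinearMap.comp_apply, bra,
    restrict_adjoint_ket, inner_ket, restrict_apply]

theorem hasSum_tr_block {κ ι : Type} (f : κ ↪ ι) (A : TraceClass ι) :
    HasSum (fun z => tr (block f z z A).1) (tr A.1) := by
  have h := (summable_tr A.2).hasSum
  have h' := (Equiv.ofBijective _ (glue_bijective f)).hasSum_iff.2 h
  refine h'.prod_fiberwise fun z => ?_
  have := (summable_tr (block f z z A).2).hasSum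
  simp only [inner_ket_block] at this
  convert! this using 1
  simp only [tr, inner_ket_block]

/-- The partial trace `∑_z ⟨z| A |z⟩` of a trace-class operator on `H_ι`, over all the qubits outside
the range of `f : κ ↪ ι`; it is an operator on `H_κ`. -/
def partialTrace {κ ι : Type} (f : κ ↪ ι) (A : TraceClass ι) : Op κ :=
  ∑' z, (block f z z A).1

theorem partialTrace_of_isEmpty {κ ι : Type} [IsEmpty κ] (f : κ ↪ ι) (A : TraceClass ι) :
    partialTrace f A = tr A.1 • (1 : Op κ) := by
  have key : ∀ z, (block f z z A).1 = tr (block f z z A).1 • (1 : Op κ) := by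
    intro z
    have hk : ∀ s : Finset κ, s = ∅ := fun s => Finset.eq_empty_of_isEmpty s
    ext v s
    have hv : v = v ∅ • ket ∅ := by
      ext t
      classical
      rw [hk t]
      simp [ket_apply]
    rw [hk s, hv]
    simp only [map_smul, smul_apply, one_apply_eq_self]
    rw [tr, tsum_eq_single ∅ (fun t ht => absurd (hk t) ht)]
    rw [inner_ket]
    classical
    simp [ket_apply, mul_comm]
  rw [partialTrace, tsum_congr key]
  exact ((hasSum_tr_block f A).smul_const (1 : Op κ)).tsum_eq

/-! ## Super-operators -/

/-- The operator `(A i j)` on the direct sum of copies of `H_ι`, i.e. on `ℂᵐ ⊗ H_ι`, is positive. -/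
def BlockPositive {ι m : Type} [Fintype m] (A : Matrix m m (TraceClass ι)) : Prop :=
  ∀ v : m → Hil ι, 0 ≤ ∑ i, ∑ j, ⟪v i, (A i j).1 (v j)⟫_ℂ

/-- `E` is completely positive: all the maps `id ⊗ E` on operators on `ℂᵐ ⊗ H_ι` preserve
positivity. -/
def IsCompletelyPositive {ι : Type} (E : Module.End ℂ (TraceClass ι)) : Prop :=
  ∀ (m : Type) [Fintype m] (A : Matrix m m (TraceClass ι)),
    BlockPositive A → BlockPositive (A.map E)

/-- `CP(H_ι)`: the semiring of completely positive super-operators; the product is composition. -/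
def CP (ι : Type) : Subsemiring (Module.End ℂ (TraceClass ι)) where
  carrier := {E | IsCompletelyPositive E}
  mul_mem' := by
    intro E F hE hF m _ A hA
    exact hE m _ (hF m A hA)
  one_mem' := by
    intro m _ A hA
    exact hA
  add_mem' := by
    intro E F hE hF m _ A hA v
    have h := add_nonneg (hE m A hA v) (hF m A hA v)
    simp only [← Finset.sum_add_distrib, Matrix.map_apply, ← inner_add_right] at h
    exact h
  zero_mem' := by
    intro m _ A hA v
    simp

theorem CP.isPositive {ι : Type} (E : CP ι) {A : TraceClass ι} (hA : A.1.IsPositive) :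
    (E.1 A).1.IsPositive := by
  have h := E.2 Unit (fun _ _ => A) (fun v => by
    simpa using hA.inner_nonneg_right (v ()))
  rw [ContinuousLinearMap.isPositive_iff_complex]
  intro x
  have hx : 0 ≤ ⟪x, (E.1 A).1 x⟫_ℂ := by
    have := h (fun _ => x)
    simp only [Finset.univ_unique, Finset.sum_singleton] at this
    exact this
  have h2 : ⟪(E.1 A).1 x, x⟫_ℂ = (starRingEnd ℂ) ⟪x, (E.1 A).1 x⟫_ℂ := (inner_conj_symm _ _).symm
  rw [h2]
  generalize ⟪x, (E.1 A).1 x⟫_ℂ = c at hx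
  rw [Complex.le_def] at hx
  refine ⟨Complex.ext (by simp) (by simpa using hx.2.symm), by simpa using hx.1⟩

/-- A super-operator is trace preserving. -/
def IsTracePreserving {ι : Type} (E : CP ι) : Prop :=
  ∀ A : TraceClass ι, A.1.IsPositive → tr (E.1 A).1 = tr A.1

/-- `CPₜ(H_ι)`: the monoid of trace-preserving completely positive super-operators. -/
def CPt (ι : Type) : Submonoid (CP ι) where
  carrier := {E | IsTracePreserving E}
  one_mem' := fun _ _ => rfl
  mul_mem' := by
    intro E F hE hF A hA
    exact (hE _ (CP.isPositive F hA)).trans (hF A hA)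

/-- The super-operator `A ↦ K A K†` with the single Kraus operator `K`. -/
def kraus {ι : Type} (K : Op ι) : CP ι :=
  ⟨sandwich K K.adjoint, by
    intro m _ A hA v
    have h := hA (fun i => K.adjoint (v i))
    simpa [sandwich, ContinuousLinearMap.adjoint_inner_left] using h⟩

theorem hasSum_bra {κ ι : Type} (f : κ ↪ ι) (v : Hil ι) :
    HasSum (fun z => (bra f z).adjoint (bra f z v)) v := by
  have h' := (Equiv.ofBijective _ (glue_bijective f)).hasSum_iff.2 (hasSum_ket v)
  refine h'.prod_fiberwise fun z => ?_
  have := (hasSum_ket (bra f z v)).mapL (bra f z).adjoint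
  simp only [map_smul, bra, restrict_adjoint_ket, restrict_apply] at this
  exact this

/-- `E'` is the extension `E ⊗ id` of the super-operator `E`, which acts on the qubits in the range
of `f : κ ↪ ι`, to all the qubits `ι`: for all basis states `|z⟩`, `|w⟩` of the other qubits,
`⟨z| E'(A) |w⟩ = E(⟨z| A |w⟩)`. -/
def IsExtension {κ ι : Type} (f : κ ↪ ι) (E : CP κ) (E' : CP ι) : Prop :=
  ∀ A z w, block f z w (E'.1 A) = E.1 (block f z w A)

theorem isCompletelyPositive_of_block {κ ι : Type} (f : κ ↪ ι) (E : CP κ)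
    (E' : Module.End ℂ (TraceClass ι)) (h : ∀ A z w, block f z w (E' A) = E.1 (block f z w A)) :
    IsCompletelyPositive E' := by
  classical
  intro m _ A hA v
  -- the values on the truncations of `v` to finitely many basis states of the other qubits
  let P : Finset (Finset ↥(Set.range f)ᶜ) → Hil _ → Hil _ := fun Z v =>
    ∑ z ∈ Z, (bra f z).adjoint (bra f z v)
  have hlim : Filter.Tendsto (fun Z => ∑ i, ∑ j, ⟪P Z (v i), (E' (A i j)).1 (P Z (v j))⟫_ℂ)
      Filter.atTop (nhds (∑ i, ∑ j, ⟪v i, (E' (A i j)).1 (v j)⟫_ℂ)) := by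
    refine tendsto_finsetSum _ fun i _ => tendsto_finsetSum _ fun j _ => ?_
    exact (hasSum_bra f (v i)).inner (((E' (A i j)).1.continuous.tendsto _).comp
      (hasSum_bra f (v j)))
  refine ge_of_tendsto' hlim fun Z => ?_
  have hpos := E.2 (m × Z) (fun p q => block f p.2 q.2 (A p.1 q.1)) (fun u => by
    have h0 := hA (fun i => ∑ z : Z, (bra f z).adjoint (u (i, z)))
    refine h0.trans_eq ?_
    simp only [Fintype.sum_prod_type, map_sum, sum_inner, inner_sum, inner_block]
    refine Finset.sum_congr rfl fun i _ => ?_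
    conv_rhs => rw [Finset.sum_comm]
    refine Finset.sum_congr rfl fun j _ => ?_
    rw [Finset.sum_comm])
    (fun p => bra f p.2 (v p.1))
  have e : ∀ i j z w, ⟪bra f z (v i), (E.1 (block f z w (A i j))).1 (bra f w (v j))⟫_ℂ =
      ⟪(bra f z).adjoint (bra f z (v i)), (E' (A i j)).1 ((bra f w).adjoint (bra f w (v j)))⟫_ℂ := by
    intro i j z w
    rw [← h, inner_block]
  refine hpos.trans_eq ?_
  simp only [P, Fintype.sum_prod_type, map_sum, sum_inner, inner_sum, Matrix.map]
  refine Finset.sum_congr rfl fun i _ => ?_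
  rw [Finset.sum_comm]
  refine Finset.sum_congr rfl fun j _ => ?_
  rw [Finset.sum_comm, ← Finset.sum_coe_sort Z]
  refine Finset.sum_congr rfl fun w _ => ?_
  rw [← Finset.sum_coe_sort Z]
  refine Finset.sum_congr rfl fun z _ => ?_
  exact e i j z w

/-- The operator `⟨a|` on the qubits in the range of `f`. -/
def row {κ ι : Type} (f : κ ↪ ι) (a : Finset κ) : Hil ι →L[ℂ] Hil ↥(Set.range f)ᶜ :=
  restrict (fun z => glue f a z) (glue_right_injective f a)

open Classical in
theorem row_ket {κ ι : Type} (f : κ ↪ ι) (a y : Finset κ) (w : Finset ↥(Set.range f)ᶜ) :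
    row f a (ket (glue f y w)) = if a = y then ket w else 0 := by
  ext t
  rw [row, restrict_apply, ket_apply]
  have : glue f a t = glue f y w ↔ t = w ∧ a = y :=
    ((glue_bijective f).1.eq_iff (a := (t, a)) (b := (w, y))).trans Prod.ext_iff
  by_cases h : a = y
  · subst h
    rw [if_pos rfl, ket_apply]
    simp only [this, and_true]
  · simp [this, h]

theorem op_ext {ι : Type} {A B : Op ι} (h : ∀ x y, ⟪ket x, A (ket y)⟫_ℂ = ⟪ket x, B (ket y)⟫_ℂ) :
    A = B := by
  ext v s
  have h1 := ((hasSum_ket v).mapL A).mapL (innerSL ℂ (ket s))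
  have h2 := ((hasSum_ket v).mapL B).mapL (innerSL ℂ (ket s))
  simp only [map_smul, innerSL_apply_apply, h] at h1 h2
  have := h1.unique h2
  simpa only [inner_ket] using this

/-- The operator `|a⟩⟨b|`, which is trace class. -/
def ketBra {ι : Type} (a b : Finset ι) : TraceClass ι :=
  ⟨InnerProductSpace.rankOne ℂ (ket a) (ket b),
    IsTraceClass.of_countable (I := Unit) (fun _ => ket a) (fun _ => ket b)
      (Summable.of_finite) (fun x => by simp)⟩

theorem eq_sum_ketBra {ι : Type} [Fintype ι] (A : TraceClass ι) :
    A = ∑ a, ∑ b, ⟪ket a, A.1 (ket b)⟫_ℂ • ketBra a b := by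
  classical
  refine Subtype.ext (op_ext fun x y => ?_)
  simp only [Submodule.coe_sum, Submodule.coe_smul, ketBra, sum_apply,
    smul_apply, InnerProductSpace.rankOne_apply, inner_sum, inner_smul_right, inner_ket, ket_apply]
  simp

theorem exists_extension {κ ι : Type} [Fintype κ] (f : κ ↪ ι) (E : CP κ) :
    ∃ E' : CP ι, IsExtension f E E' := by
  classical
  let E' : Module.End ℂ (TraceClass ι) :=
    ∑ a : Finset κ, ∑ b : Finset κ, ∑ c : Finset κ, ∑ d : Finset κ,
      ⟪ket c, (E.1 (ketBra a b)).1 (ket d)⟫_ℂ •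
        sandwich ((row f c).adjoint ∘L row f a) ((row f b).adjoint ∘L row f d)
  have h : ∀ A z w, block f z w (E' A) = E.1 (block f z w A) := by
    intro A z w
    refine Subtype.ext (op_ext fun x y => ?_)
    rw [inner_ket_block]
    conv_rhs => rw [eq_sum_ketBra (block f z w A)]
    have key : ∀ a b c d, ⟪ket (glue f x z), (sandwich ((row f c).adjoint ∘L row f a)
        ((row f b).adjoint ∘L row f d) A).1 (ket (glue f y w))⟫_ℂ =
        if d = y then (if c = x then ⟪ket (glue f a z), A.1 (ket (glue f b w))⟫_ℂ else 0) else 0 := by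
      intro a b c d
      simp only [sandwich, LinearMap.coe_mk, AddHom.coe_mk, ContinuousLinearMap.comp_apply, row_ket,
        ContinuousLinearMap.adjoint_inner_right]
      by_cases hc : c = x
      · by_cases hd : d = y
        · simp only [hc, hd, if_true, row, restrict_adjoint_ket]
          rw [← ContinuousLinearMap.adjoint_inner_left, restrict_adjoint_ket]
        · simp [hc, hd]
      · simp [hc]
    simp only [E', map_sum, map_smul, inner_ket_block, LinearMap.sum_apply, LinearMap.smul_apply,
      Submodule.coe_sum, Submodule.coe_smul, sum_apply, smul_apply, inner_sum,
      inner_smul_right, key]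
    simp only [mul_ite, mul_zero, Finset.sum_ite_eq', Finset.mem_univ, if_true]
    exact Finset.sum_congr rfl fun a _ => Finset.sum_congr rfl fun b _ => mul_comm _ _
  exact ⟨⟨E', isCompletelyPositive_of_block f E E' h⟩, h⟩

theorem IsExtension.isTracePreserving {κ ι : Type} {f : κ ↪ ι} {E : CP κ} {E' : CP ι}
    (h : IsExtension f E E') (hE : IsTracePreserving E) : IsTracePreserving E' := by
  intro A hA
  refine (hasSum_tr_block f _).unique ?_
  convert! hasSum_tr_block f A using 2 with z
  rw [h A z z]
  exact hE _ (hA.conj_adjoint (bra f z))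

/-- The extension `E ⊗ id` of a super-operator on finitely many qubits, acting on the qubits in the
range of `f`. -/
def extend {κ ι : Type} [Fintype κ] (f : κ ↪ ι) (E : CP κ) : CP ι :=
  (exists_extension f E).choose

theorem isExtension_extend {κ ι : Type} [Fintype κ] (f : κ ↪ ι) (E : CP κ) :
    IsExtension f E (extend f E) :=
  (exists_extension f E).choose_spec

/-- The extension of a trace-preserving super-operator. -/
def extendT {κ ι : Type} [Fintype κ] (f : κ ↪ ι) (E : CPt κ) : CPt ι :=
  ⟨extend f E.1, (isExtension_extend f E.1).isTracePreserving E.2⟩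

theorem tr_eq_sum {ι I : Type} [Fintype I] (φ : OrthonormalBasis I ℂ (Hil ι)) (A : TraceClass ι) :
    ∑ i, ⟪φ i, A.1 (φ i)⟫_ℂ = tr A.1 := by
  obtain ⟨A, v, w, hs, hA⟩ := A
  rw [tr, (hasSum_tr hs hA).tsum_eq]
  have h := hasSum_sum (s := Finset.univ) (fun i _ => (hA (φ i)).mapL (innerSL ℂ (φ i)))
  simp only [innerSL_apply_apply, inner_smul_right, φ.sum_inner_mul_inner] at h
  exact h.tsum_eq.symm

/-- The super-operator `ρ ↦ |φ⟩⟨φ| ρ |φ⟩⟨φ|`. -/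
def measA {ι : Type} (φ : Hil ι) : CP ι := kraus (InnerProductSpace.rankOne ℂ φ φ)

/-- The super-operator `ρ ↦ ∑ⱼ |φᵢ⟩⟨φⱼ| ρ |φⱼ⟩⟨φᵢ|`, for an orthonormal basis `(φᵢ)`. -/
def measSet {ι I : Type} [Fintype I] (φ : OrthonormalBasis I ℂ (Hil ι)) (i : I) : CPt ι :=
  ⟨∑ j, kraus (InnerProductSpace.rankOne ℂ (φ i) (φ j)), by
    intro A _
    rw [← tr_eq_sum φ, ← tr_eq_sum φ]
    simp only [AddSubmonoidClass.coe_finsetSum, LinearMap.sum_apply, sum_apply,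
      inner_sum, kraus, sandwich, LinearMap.coe_mk, AddHom.coe_mk, ContinuousLinearMap.comp_apply]
    rw [Finset.sum_comm]
    refine Finset.sum_congr rfl fun j _ => ?_
    classical
    simp only [InnerProductSpace.adjoint_rankOne, InnerProductSpace.rankOne_apply, map_smul,
      inner_smul_right, φ.inner_eq_ite]
    simp⟩

/-! ## Comparison of super-operators -/

/-- `ρ` is a density operator. -/
def IsDensity {ι : Type} (ρ : TraceClass ι) : Prop := ρ.1.IsPositive ∧ tr ρ.1 = 1

/-- `A ≲_V B`: for all density operators `ρ`, `tr_{Vᶜ} A(ρ) ⊑ tr_{Vᶜ} B(ρ)`, where `tr_{Vᶜ}` traces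
out all the qubits outside `V` and `⊑` is the Löwner order. -/
def LesssimOn {ι : Type} (V : Set ι) (A B : CP ι) : Prop :=
  ∀ ρ : TraceClass ι, IsDensity ρ →
    partialTrace (Function.Embedding.subtype (· ∈ V)) (A.1 ρ) ≤
      partialTrace (Function.Embedding.subtype (· ∈ V)) (B.1 ρ)

/-- `A ≂_V B`. -/
def EqsimOn {ι : Type} (V : Set ι) (A B : CP ι) : Prop := LesssimOn V A B ∧ LesssimOn V B A

/-- `A ≂ B`, that is `A ≂_∅ B`. -/
def Eqsim {ι : Type} (A B : CP ι) : Prop := EqsimOn ∅ A B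

theorem IsDensity.apply {ι : Type} {ρ : TraceClass ι} (h : IsDensity ρ) (E : CPt ι) :
    IsDensity (E.1.1 ρ) :=
  ⟨CP.isPositive E.1 h.1, (E.2 ρ h.1).trans h.2⟩

theorem Eqsim.mul_right {ι : Type} {A : CP ι} (h : Eqsim A 1) (E : CPt ι) :
    Eqsim (A * (E : CP ι)) 1 := by
  have key : ∀ ρ : TraceClass ι, IsDensity ρ →
      partialTrace (Function.Embedding.subtype (· ∈ (∅ : Set ι))) (E.1.1 ρ) =
      partialTrace (Function.Embedding.subtype (· ∈ (∅ : Set ι))) ρ := by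
    intro ρ hρ
    have : IsEmpty {i // i ∈ (∅ : Set ι)} := ⟨fun i => i.2⟩
    rw [partialTrace_of_isEmpty, partialTrace_of_isEmpty, E.2 ρ hρ.1]
  constructor
  · intro ρ hρ
    exact (h.1 _ (hρ.apply E)).trans_eq (key ρ hρ)
  · intro ρ hρ
    exact (key ρ hρ).symm.trans_le (h.2 _ (hρ.apply E))

/-- `G ∈ CPₜ(H_V)`, regarded as the super-operator `G ⊗ id` on the state space of all the qubits. -/
def ActsOn {ι : Type} (V : Set ι) (G : CPt ι) : Prop :=
  ∃ G₀ : CPt V, IsExtension (Function.Embedding.subtype (· ∈ V)) G₀.1 G.1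

/-! ## Syntax of qCCS

Classical variables and quantum variables are natural numbers; each quantum variable is a qubit.
Terms up to `α`-conversion are represented with nested scopes: a syntactic object over `X` (and `Q`)
has its free classical variables in `X` (and its free quantum variables in `Q`), and the scope of a
binder is a term over `Option X` (or `Option Q`), in which `none` is the bound variable. -/

/-- The names that a qCCS language is built on: classical and quantum channels, process constant
schemes with their arities, and interpreted function and predicate symbols for the data
expressions and the boolean expressions. -/
structure Sig where
  CChan : Type
  QChan : Type
  Const : Type
  /-- The number of classical parameters. -/
  arc : Const → ℕ
  /-- The number of quantum parameters. -/
  arq : Const → ℕ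
  Fn : Type
  fnArity : Fn → ℕ
  fnInterp : (f : Fn) → (Fin (fnArity f) → ℝ) → ℝ
  Pr : Type
  prArity : Pr → ℕ
  prInterp : (p : Pr) → (Fin (prArity p) → ℝ) → Prop

/-- Data expressions over the reals. -/
inductive Exp (L : Sig) (X : Type) : Type
  | var (x : X) : Exp L X
  | const (v : ℝ) : Exp L X
  | app (f : L.Fn) (e : Fin (L.fnArity f) → Exp L X) : Exp L X

namespace Exp

variable {L : Sig} {X Y : Type}

def eval (ψ : X → ℝ) : Exp L X → ℝ
  | var x => ψ x
  | const v => v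
  | app f e => L.fnInterp f fun i => (e i).eval ψ

def fv : Exp L X → Set X
  | var x => {x}
  | const _ => ∅
  | app _ e => ⋃ i, (e i).fv

def subst (σ : X → Exp L Y) : Exp L X → Exp L Y
  | var x => σ x
  | const v => const v
  | app f e => app f fun i => (e i).subst σ

end Exp

/-- The comparison symbols. -/
inductive Cmp : Type
  | gt | lt | ge | le | eq

def Cmp.holds : Cmp → ℝ → ℝ → Prop
  | gt, a, b => a > b
  | lt, a, b => a < b
  | ge, a, b => a ≥ b
  | le, a, b => a ≤ b
  | eq, a, b => a = b

/-- Boolean expressions. -/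
inductive BExp (L : Sig) (X : Type) : Type
  | tt : BExp L X
  | ff : BExp L X
  | neg (b : BExp L X) : BExp L X
  | and (b c : BExp L X) : BExp L X
  | or (b c : BExp L X) : BExp L X
  | imp (b c : BExp L X) : BExp L X
  | cmp (r : Cmp) (e e' : Exp L X) : BExp L X
  | pred (p : L.Pr) (e : Fin (L.prArity p) → Exp L X) : BExp L X

namespace BExp

variable {L : Sig} {X Y : Type}

/-- `ψ(b) = true`. -/
def holds (ψ : X → ℝ) : BExp L X → Prop
  | tt => True
  | ff => False
  | neg b => ¬ b.holds ψ
  | and b c => b.holds ψ ∧ c.holds ψ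
  | or b c => b.holds ψ ∨ c.holds ψ
  | imp b c => b.holds ψ → c.holds ψ
  | cmp r e e' => r.holds (e.eval ψ) (e'.eval ψ)
  | pred p e => L.prInterp p fun i => (e i).eval ψ

def fv : BExp L X → Set X
  | tt => ∅
  | ff => ∅
  | neg b => b.fv
  | and b c => b.fv ∪ c.fv
  | or b c => b.fv ∪ c.fv
  | imp b c => b.fv ∪ c.fv
  | cmp _ e e' => e.fv ∪ e'.fv
  | pred _ e => ⋃ i, (e i).fv

def subst (σ : X → Exp L Y) : BExp L X → BExp L Y
  | tt => tt
  | ff => ff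
  | neg b => neg (b.subst σ)
  | and b c => and (b.subst σ) (c.subst σ)
  | or b c => or (b.subst σ) (c.subst σ)
  | imp b c => imp (b.subst σ) (c.subst σ)
  | cmp r e e' => cmp r (e.subst σ) (e'.subst σ)
  | pred p e => pred p fun i => (e i).subst σ

def Satisfiable (b : BExp L X) : Prop := ∃ ψ, b.holds ψ

/-- `b → c`, i.e. the implication is valid. -/
def Entails (b c : BExp L X) : Prop := ∀ ψ, b.holds ψ → c.holds ψ

/-- `b → ⋁ B`, i.e. the implication is valid. -/
def EntailsDisj (b : BExp L X) (B : Set (BExp L X)) : Prop :=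
  ∀ ψ, b.holds ψ → ∃ c ∈ B, c.holds ψ

end BExp

/-- A non-degenerate projective measurement of `n` qubits: a Hermitian operator all of whose
eigenspaces are at most one-dimensional. -/
structure Measurement (n : ℕ) where
  op : Op (Fin n)
  hermitian : IsSelfAdjoint op
  nondegenerate : ∀ c : ℂ, Module.finrank ℂ (Module.End.eigenspace op.toLinearMap c) ≤ 1

/-- Raw process terms. -/
inductive Tm (L : Sig) : Type → Type → Type 1
  /-- `nil` -/
  | nil {X Q : Type} : Tm L X Q
  /-- `A(e, q)` -/
  | call {X Q : Type} (A : L.Const) (e : Fin (L.arc A) → Exp L X) (q : Fin (L.arq A) → Q) : Tm L X Q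
  /-- `τ.t` -/
  | tau {X Q : Type} (t : Tm L X Q) : Tm L X Q
  /-- `c?x.t` -/
  | inp {X Q : Type} (c : L.CChan) (t : Tm L (Option X) Q) : Tm L X Q
  /-- `c!e.t` -/
  | out {X Q : Type} (c : L.CChan) (e : Exp L X) (t : Tm L X Q) : Tm L X Q
  /-- `c?q.t` for a quantum channel -/
  | qinp {X Q : Type} (c : L.QChan) (t : Tm L X (Option Q)) : Tm L X Q
  /-- `c!q.t` for a quantum channel -/
  | qout {X Q : Type} (c : L.QChan) (q : Q) (t : Tm L X Q) : Tm L X Q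
  /-- `F[q].t` -/
  | oper {X Q : Type} {n : ℕ} (F : CPt (Fin n)) (q : Fin n → Q) (t : Tm L X Q) : Tm L X Q
  /-- `M[q; x].t` -/
  | meas {X Q : Type} {n : ℕ} (M : Measurement n) (q : Fin n → Q) (t : Tm L (Option X) Q) : Tm L X Q
  /-- `t + u` -/
  | sum {X Q : Type} (t u : Tm L X Q) : Tm L X Q
  /-- `t ∥ u` -/
  | par {X Q : Type} (t u : Tm L X Q) : Tm L X Q
  /-- the restriction of `t` by a set of channels -/
  | res {X Q : Type} (t : Tm L X Q) (C : Set (L.CChan ⊕ L.QChan)) : Tm L X Q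
  /-- the relabelling of `t` by an injection of channels that respects their kinds -/
  | rel {X Q : Type} (t : Tm L X Q) (f : L.CChan ↪ L.CChan) (g : L.QChan ↪ L.QChan) : Tm L X Q
  /-- `if b then t` -/
  | cond {X Q : Type} (b : BExp L X) (t : Tm L X Q) : Tm L X Q

namespace Tm

variable {L : Sig}

/-- Free quantum variables. -/
def qv {X Q : Type} : Tm L X Q → Set Q
  | nil => ∅
  | call _ _ q => Set.range q
  | tau t => t.qv
  | inp _ t => t.qv
  | out _ _ t => t.qv
  | qinp _ t => {q | some q ∈ t.qv}
  | qout _ q t => t.qv ∪ {q}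
  | oper _ q t => t.qv ∪ Set.range q
  | meas _ q t => t.qv ∪ Set.range q
  | sum t u => t.qv ∪ u.qv
  | par t u => t.qv ∪ u.qv
  | res t _ => t.qv
  | rel t _ _ => t.qv
  | cond _ t => t.qv

/-- Free classical variables. -/
def fv {X Q : Type} : Tm L X Q → Set X
  | nil => ∅
  | call _ e _ => ⋃ i, (e i).fv
  | tau t => t.fv
  | inp _ t => {x | some x ∈ t.fv}
  | out _ e t => e.fv ∪ t.fv
  | qinp _ t => t.fv
  | qout _ _ t => t.fv
  | oper _ _ t => t.fv
  | meas _ _ t => {x | some x ∈ t.fv}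
  | sum t u => t.fv ∪ u.fv
  | par t u => t.fv ∪ u.fv
  | res t _ => t.fv
  | rel t _ _ => t.fv
  | cond b t => b.fv ∪ t.fv

/-- Simultaneous (capture-avoiding) substitution of expressions for classical variables and renaming
of quantum variables. -/
def subst {X Q Y R : Type} (σ : X → Exp L Y) (ρ : Q → R) : Tm L X Q → Tm L Y R
  | nil => nil
  | call A e q => call A (fun i => (e i).subst σ) (ρ ∘ q)
  | tau t => tau (t.subst σ ρ)
  | inp c t => inp c (t.subst (liftSubst σ) ρ)
  | out c e t => out c (e.subst σ) (t.subst σ ρ)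
  | qinp c t => qinp c (t.subst σ (Option.map ρ))
  | qout c q t => qout c (ρ q) (t.subst σ ρ)
  | oper F q t => oper F (ρ ∘ q) (t.subst σ ρ)
  | meas M q t => meas M (ρ ∘ q) (t.subst (liftSubst σ) ρ)
  | sum t u => sum (t.subst σ ρ) (u.subst σ ρ)
  | par t u => par (t.subst σ ρ) (u.subst σ ρ)
  | res t C => res (t.subst σ ρ) C
  | rel t f g => rel (t.subst σ ρ) f g
  | cond b t => cond (b.subst σ) (t.subst σ ρ)
where
  /-- The extension of a substitution to the scope of a binder. -/
  liftSubst {X Y : Type} (σ : X → Exp L Y) : Option X → Exp L (Option Y)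
    | none => Exp.var none
    | some x => (σ x).subst fun y => Exp.var (some y)

/-- The syntactic restrictions: a quantum variable that has been sent is not used any more, parallel
processes share no quantum variables, and the quantum variables in a tuple are distinct. -/
def WF {X Q : Type} : Tm L X Q → Prop
  | nil => True
  | call _ _ q => Function.Injective q
  | tau t => t.WF
  | inp _ t => t.WF
  | out _ _ t => t.WF
  | qinp _ t => t.WF
  | qout _ q t => q ∉ t.qv ∧ t.WF
  | oper _ q t => Function.Injective q ∧ t.WF
  | meas _ q t => Function.Injective q ∧ t.WF
  | sum t u => t.WF ∧ u.WF
  | par t u => Disjoint t.qv u.qv ∧ t.WF ∧ u.WF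
  | res t _ => t.WF
  | rel t _ _ => t.WF
  | cond _ t => t.WF

/-- Instantiates the bound classical variable of a scope. -/
def inst (t : Tm L (Option ℕ) ℕ) (e : Exp L ℕ) : Tm L ℕ ℕ :=
  t.subst (fun o => o.elim e Exp.var) id

/-- Instantiates the bound quantum variable of a scope. -/
def instQ (t : Tm L ℕ (Option ℕ)) (r : ℕ) : Tm L ℕ ℕ :=
  t.subst Exp.var (fun o => o.getD r)

/-- `t{e/x}` -/
def replace (t : Tm L ℕ ℕ) (x : ℕ) (e : Exp L ℕ) : Tm L ℕ ℕ :=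
  t.subst (fun y => if y = x then e else Exp.var y) id

end Tm

/-- The process terms. -/
abbrev Term (L : Sig) : Type 1 := {t : Tm L ℕ ℕ // t.WF}

/-- The defining equations `A(x, q) = t` of the process constants; the free variables of `t` are
among the parameters. -/
structure Defs (L : Sig) where
  body : (A : L.Const) → Tm L (Fin (L.arc A)) (Fin (L.arq A))
  wf : ∀ A, (body A).WF

/-! ## Symbolic transitional semantics -/

/-- The symbolic actions. -/
inductive Act (L : Sig) : Type
  | tau : Act L
  | inp (c : L.CChan) (x : ℕ) : Act L
  | out (c : L.CChan) (e : Exp L ℕ) : Act L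
  | qinp (c : L.QChan) (r : ℕ) : Act L
  | qout (c : L.QChan) (r : ℕ) : Act L

namespace Act

variable {L : Sig}

/-- Bound classical variables. -/
def bv : Act L → Set ℕ
  | inp _ x => {x}
  | _ => ∅

/-- Bound quantum variables. -/
def qbv : Act L → Set ℕ
  | qinp _ r => {r}
  | _ => ∅

/-- Channel names. -/
def cn : Act L → Set (L.CChan ⊕ L.QChan)
  | tau => ∅
  | inp c _ => {Sum.inl c}
  | out c _ => {Sum.inl c}
  | qinp c _ => {Sum.inr c}
  | qout c _ => {Sum.inr c}

/-- Relabelling of the channel name. -/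
def relabel (f : L.CChan ↪ L.CChan) (g : L.QChan ↪ L.QChan) : Act L → Act L
  | tau => tau
  | inp c x => inp (f c) x
  | out c e => out (f c) e
  | qinp c r => qinp (g c) r
  | qout c r => qout (g c) r

/-- `γ =_b γ'`: both are outputs of expressions on the same channel which are equal if `b` holds, or
they are the same action and not a classical output. -/
inductive EqUnder (b : BExp L ℕ) : Act L → Act L → Prop
  | out (c : L.CChan) (e e' : Exp L ℕ) (h : b.Entails (BExp.cmp Cmp.eq e e')) :
      EqUnder b (out c e) (out c e')
  | refl (γ : Act L) (h : ∀ c e, γ ≠ out c e) : EqUnder b γ γ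

end Act

/-- Pairs of a raw term and a trace-preserving super-operator on the space of all the qubits. -/
abbrev RawSnap (L : Sig) : Type 1 := Tm L ℕ ℕ × CPt ℕ

/-- The symbolic transitions `⟮t, E⟯ → Δ` with label `b, γ` of raw terms; here `Δ` is a function of
finite support from snapshots to super-operators. -/
inductive RawStep {L : Sig} (D : Defs L) :
    RawSnap L → BExp L ℕ → Act L → (RawSnap L →₀ CP ℕ) → Prop
  | tau (t : Tm L ℕ ℕ) (E : CPt ℕ) :
      RawStep D (t.tau, E) BExp.tt Act.tau (Finsupp.single (t, E) 1)
  | inp (c : L.CChan) (t : Tm L (Option ℕ) ℕ) (E : CPt ℕ) (x : ℕ) (hx : x ∉ (Tm.inp c t).fv) :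
      RawStep D (Tm.inp c t, E) BExp.tt (Act.inp c x) (Finsupp.single (t.inst (Exp.var x), E) 1)
  | out (c : L.CChan) (e : Exp L ℕ) (t : Tm L ℕ ℕ) (E : CPt ℕ) :
      RawStep D (Tm.out c e t, E) BExp.tt (Act.out c e) (Finsupp.single (t, E) 1)
  | qinp (c : L.QChan) (t : Tm L ℕ (Option ℕ)) (E : CPt ℕ) (r : ℕ) (hr : r ∉ (Tm.qinp c t).qv) :
      RawStep D (Tm.qinp c t, E) BExp.tt (Act.qinp c r) (Finsupp.single (t.instQ r, E) 1)
  | qout (c : L.QChan) (q : ℕ) (t : Tm L ℕ ℕ) (E : CPt ℕ) :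
      RawStep D (Tm.qout c q t, E) BExp.tt (Act.qout c q) (Finsupp.single (t, E) 1)
  | oper {n : ℕ} (F : CPt (Fin n)) (q : Fin n ↪ ℕ) (t : Tm L ℕ ℕ) (E : CPt ℕ) :
      RawStep D (Tm.oper F q t, E) BExp.tt Act.tau (Finsupp.single (t, extendT q F * E) 1)
  | meas {n : ℕ} (M : Measurement n) (q : Fin n ↪ ℕ) (t : Tm L (Option ℕ) ℕ) (E : CPt ℕ)
      {I : Type} [Fintype I] (φ : OrthonormalBasis I ℂ (Hil (Fin n))) (l : I → ℝ)
      (hM : ∀ i, M.op (φ i) = (l i : ℂ) • φ i) :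
      RawStep D (Tm.meas M q t, E) BExp.tt Act.tau
        (∑ i, Finsupp.single (t.inst (Exp.const (l i)), extendT q (measSet φ i) * E)
          (extend q (measA (φ i))))
  | sumL {t : Tm L ℕ ℕ} {E : CPt ℕ} {b : BExp L ℕ} {γ : Act L} {Δ : RawSnap L →₀ CP ℕ}
      (u : Tm L ℕ ℕ) (h : RawStep D (t, E) b γ Δ) : RawStep D (t.sum u, E) b γ Δ
  | sumR {u : Tm L ℕ ℕ} {E : CPt ℕ} {b : BExp L ℕ} {γ : Act L} {Δ : RawSnap L →₀ CP ℕ}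
      (t : Tm L ℕ ℕ) (h : RawStep D (u, E) b γ Δ) : RawStep D (t.sum u, E) b γ Δ
  | parL {t : Tm L ℕ ℕ} {E : CPt ℕ} {b : BExp L ℕ} {γ : Act L} {Δ : RawSnap L →₀ CP ℕ}
      (u : Tm L ℕ ℕ) (h : RawStep D (t, E) b γ Δ) (hc : Disjoint γ.bv u.fv)
      (hq : Disjoint γ.qbv u.qv) :
      RawStep D (t.par u, E) b γ (Δ.mapDomain fun s => (s.1.par u, s.2))
  | parR {u : Tm L ℕ ℕ} {E : CPt ℕ} {b : BExp L ℕ} {γ : Act L} {Δ : RawSnap L →₀ CP ℕ}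
      (t : Tm L ℕ ℕ) (h : RawStep D (u, E) b γ Δ) (hc : Disjoint γ.bv t.fv)
      (hq : Disjoint γ.qbv t.qv) :
      RawStep D (t.par u, E) b γ (Δ.mapDomain fun s => (t.par s.1, s.2))
  | comL {t t' u u' : Tm L ℕ ℕ} {E : CPt ℕ} {b₁ b₂ : BExp L ℕ} {c : L.CChan} {x : ℕ} {e : Exp L ℕ}
      (h₁ : RawStep D (t, E) b₁ (Act.inp c x) (Finsupp.single (t', E) 1))
      (h₂ : RawStep D (u, E) b₂ (Act.out c e) (Finsupp.single (u', E) 1)) :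
      RawStep D (t.par u, E) (b₁.and b₂) Act.tau (Finsupp.single ((t'.replace x e).par u', E) 1)
  | comR {t t' u u' : Tm L ℕ ℕ} {E : CPt ℕ} {b₁ b₂ : BExp L ℕ} {c : L.CChan} {x : ℕ} {e : Exp L ℕ}
      (h₁ : RawStep D (t, E) b₁ (Act.out c e) (Finsupp.single (t', E) 1))
      (h₂ : RawStep D (u, E) b₂ (Act.inp c x) (Finsupp.single (u', E) 1)) :
      RawStep D (t.par u, E) (b₁.and b₂) Act.tau (Finsupp.single (t'.par (u'.replace x e), E) 1)
  | qcomL {t t' u u' : Tm L ℕ ℕ} {E : CPt ℕ} {b₁ b₂ : BExp L ℕ} {c : L.QChan} {r : ℕ}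
      (h₁ : RawStep D (t, E) b₁ (Act.qinp c r) (Finsupp.single (t', E) 1))
      (h₂ : RawStep D (u, E) b₂ (Act.qout c r) (Finsupp.single (u', E) 1)) :
      RawStep D (t.par u, E) (b₁.and b₂) Act.tau (Finsupp.single (t'.par u', E) 1)
  | qcomR {t t' u u' : Tm L ℕ ℕ} {E : CPt ℕ} {b₁ b₂ : BExp L ℕ} {c : L.QChan} {r : ℕ}
      (h₁ : RawStep D (t, E) b₁ (Act.qout c r) (Finsupp.single (t', E) 1))
      (h₂ : RawStep D (u, E) b₂ (Act.qinp c r) (Finsupp.single (u', E) 1)) :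
      RawStep D (t.par u, E) (b₁.and b₂) Act.tau (Finsupp.single (t'.par u', E) 1)
  | res {t : Tm L ℕ ℕ} {E : CPt ℕ} {b : BExp L ℕ} {γ : Act L} {Δ : RawSnap L →₀ CP ℕ}
      (C : Set (L.CChan ⊕ L.QChan)) (h : RawStep D (t, E) b γ Δ) (hC : Disjoint γ.cn C) :
      RawStep D (t.res C, E) b γ (Δ.mapDomain fun s => (s.1.res C, s.2))
  | rel {t : Tm L ℕ ℕ} {E : CPt ℕ} {b : BExp L ℕ} {γ : Act L} {Δ : RawSnap L →₀ CP ℕ}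
      (f : L.CChan ↪ L.CChan) (g : L.QChan ↪ L.QChan) (h : RawStep D (t, E) b γ Δ) :
      RawStep D (t.rel f g, E) b (γ.relabel f g) (Δ.mapDomain fun s => (s.1.rel f g, s.2))
  | cond {t : Tm L ℕ ℕ} {E : CPt ℕ} {b₁ : BExp L ℕ} {γ : Act L} {Δ : RawSnap L →₀ CP ℕ}
      (b : BExp L ℕ) (h : RawStep D (t, E) b₁ γ Δ) : RawStep D (t.cond b, E) (b.and b₁) γ Δ
  | call {A : L.Const} {e : Fin (L.arc A) → Exp L ℕ} {q : Fin (L.arq A) → ℕ} {E : CPt ℕ}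
      {b : BExp L ℕ} {γ : Act L} {Δ : RawSnap L →₀ CP ℕ}
      (h : RawStep D ((D.body A).subst e q, E) b γ Δ) : RawStep D (Tm.call A e q, E) b γ Δ

/-- The snapshots `⟮t, E⟯`. -/
abbrev SN (L : Sig) : Type 1 := Term L × CPt ℕ

/-- `qv(t)` for a snapshot `⟮t, E⟯`. -/
def SN.qv {L : Sig} (s : SN L) : Set ℕ := s.1.1.qv

/-- `fv(t)` for a snapshot `⟮t, E⟯`. -/
def SN.fv {L : Sig} (s : SN L) : Set ℕ := s.1.1.fv

/-- `⟮t, G E⟯` for a snapshot `⟮t, E⟯`. -/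
def SN.act {L : Sig} (G : CPt ℕ) (s : SN L) : SN L := (s.1, G * s.2)

/-- The super-operator valued distributions of finite support on a set. -/
def SODist (S : Type 1) : Type 1 :=
  {Δ : S →₀ CP ℕ // Eqsim (Δ.sum fun _ A => A) 1}

/-- The distribution `E • Δ`, which maps `s` to `Δ(s) E`. -/
def SODist.comp {S : Type 1} (Δ : SODist S) (E : CPt ℕ) : SODist S :=
  ⟨Δ.1.mapRange (fun A => A * (E : CP ℕ)) (zero_mul _), by
    rw [Finsupp.sum_mapRange_index (fun _ => rfl)]
    have h := Δ.2.mul_right E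
    rwa [Finsupp.sum, Finset.sum_mul] at h⟩

open Classical in
/-- `Δ(T)`, the sum of the values of `Δ` on a set `T`. -/
def SODist.mass {S : Type 1} (Δ : SODist S) (T : Set S) : CP ℕ :=
  Δ.1.sum fun s A => if s ∈ T then A else 0

/-- The lifting of an equivalence relation `R` to distributions: `Δ(T) ≂ Ξ(T)` for all the
equivalence classes `T`. -/
def Lift {S : Type 1} (R : S → S → Prop) (Δ Ξ : SODist S) : Prop :=
  ∀ s, Eqsim (Δ.mass {s' | R s s'}) (Ξ.mass {s' | R s s'})

/-- The symbolic transition relation on snapshots. -/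
def Step {L : Sig} (D : Defs L) (s : SN L) (b : BExp L ℕ) (γ : Act L) (Δ : SODist (SN L)) : Prop :=
  RawStep D (s.1.1, s.2) b γ (Δ.1.mapDomain fun s' => (s'.1.1, s'.2))

/-! ## Symbolic bisimulation -/

/-- The first condition in the definition of symbolic bisimulations. -/
def StaticCond {L : Sig} (b : BExp L ℕ) (s u : SN L) : Prop :=
  b.Satisfiable → s.qv = u.qv ∧ EqsimOn s.qvᶜ s.2.1 u.2.1

/-- The second condition in the definition of symbolic bisimulations: the moves of `s` are matched by
moves of `u`. -/
def Simulates {L : Sig} (D : Defs L) (S : BExp L ℕ → SN L → SN L → Prop) (b : BExp L ℕ)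
    (s u : SN L) : Prop :=
  ∀ G : CPt ℕ, ActsOn s.qvᶜ G → ∀ (b₁ : BExp L ℕ) (γ : Act L) (Δ : SODist (SN L)),
    Step D (s.act G) b₁ γ Δ → γ.bv ∩ (b.fv ∪ s.fv ∪ u.fv) = ∅ →
    ∃ B : Set (BExp L ℕ), B.Finite ∧ (b.and b₁).EntailsDisj B ∧
      ∀ b' ∈ B, ∃ (b₂ : BExp L ℕ) (γ' : Act L) (Ξ : SODist (SN L)),
        b'.Entails b₂ ∧ Act.EqUnder b' γ γ' ∧ Step D (u.act G) b₂ γ' Ξ ∧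
        Lift (S b') (Δ.comp (G * s.2)) (Ξ.comp (G * u.2))

/-- A symbolic bisimulation: a family of equivalence relations on snapshots. -/
def IsSymbolicBisimulation {L : Sig} (D : Defs L) (S : BExp L ℕ → SN L → SN L → Prop) : Prop :=
  (∀ b, Equivalence (S b)) ∧ ∀ b s u, S b s u → StaticCond b s u ∧ Simulates D S b s u

/-- Symbolic `b`-bisimilarity `∼ᵇ` of snapshots. -/
def Bisimilar {L : Sig} (D : Defs L) (b : BExp L ℕ) (s u : SN L) : Prop :=
  ∃ S, IsSymbolicBisimulation D S ∧ S b s u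

end

end QCCS

namespace QCCS

noncomputable section

variable {L : Sig} {X Y Z Q R T : Type}

/-! ## Substitution -/

namespace Exp

/-! The theorem says that bisimilarity is a fixed point of the functional whose post-fixed points,
among families of equivalence relations, are the symbolic bisimulations. The forward direction needs
bisimilarity to be a bisimulation itself (`isSymbolicBisimulation_bisimilar`). The backward
direction adjoins one pair and its converse to bisimilarity, and needs a bisimulation that contains
the result.

Both directions must complete a union of relations to an equivalence, and the freshness condition
obstructs this. Moves from `s` to `u` are matched only when their bound variable avoids the free
variables of `b`, `s` and `u`. In a chain from `s` to `u` that variable may be free in an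
intermediate snapshot, so matchings cannot simply be composed.

The remedy is that everything is equivariant under permutations of the classical variables:
transitions (`RawStep.rename`), liftings (`Lift.map`) and matchings (`Matches.rename`). Given a
symmetric family `P`, the closure `UpTo P` adds renaming, strengthening of the condition, and finite
chains. If `P` satisfies the static condition and its moves are matched up to `UpTo P`, then `UpTo
P` is a bisimulation (`isSymbolicBisimulation_upTo`). Induction along a chain shows that moves whose
bound variable avoids some finite set are matched. Any other admissible move is first renamed by a
permutation fixing the free variables of `b`, `s` and `u`, then matched, and the answer is renamed
back (`SimulatesFresh.simulates`).

Three choices of `P` suffice: the empty family for reflexivity of bisimilarity, the union of two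
bisimulations for transitivity, and bisimilarity with the new pair and its converse for the backward
direction. -/

theorem subst_subst (σ : X → Exp L Y) (σ' : Y → Exp L Z) (e : Exp L X) :
    (e.subst σ).subst σ' = e.subst fun x => (σ x).subst σ' := by
  induction e with
  | var x => rfl
  | const v => rfl
  | app f e ih => simp only [subst, ih]

theorem subst_congr {σ σ' : X → Exp L Y} {e : Exp L X} (h : ∀ x ∈ e.fv, σ x = σ' x) :
    e.subst σ = e.subst σ' := by
  induction e with
  | var x => exact h x rfl
  | const v => rfl
  | app f e ih =>
    simp only [subst]
    congr 1
    exact funext fun i => ih i fun x hx => h x (Set.mem_iUnion.2 ⟨i, hx⟩)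

theorem subst_var (e : Exp L X) : e.subst var = e := by
  induction e with
  | var x => rfl
  | const v => rfl
  | app f e ih => simp only [subst, ih]

theorem mem_fv_subst {σ : X → Exp L Y} {e : Exp L X} {y : Y} :
    y ∈ (e.subst σ).fv ↔ ∃ x ∈ e.fv, y ∈ (σ x).fv := by
  induction e with
  | var x => simp [subst, fv]
  | const v => simp [subst, fv]
  | app f e ih =>
    simp only [subst, fv, Set.mem_iUnion, ih]
    exact ⟨fun ⟨i, x, h, h'⟩ => ⟨x, ⟨i, h⟩, h'⟩, fun ⟨x, ⟨i, h⟩, h'⟩ => ⟨i, x, h, h'⟩⟩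

theorem eval_subst (σ : X → Exp L Y) (ψ : Y → ℝ) (e : Exp L X) :
    (e.subst σ).eval ψ = e.eval fun x => (σ x).eval ψ := by
  induction e with
  | var x => rfl
  | const v => rfl
  | app f e ih => simp only [subst, eval, ih]

theorem finite_fv (e : Exp L X) : e.fv.Finite := by
  induction e with
  | var x => exact Set.finite_singleton x
  | const v => exact Set.finite_empty
  | app f e ih => exact Set.finite_iUnion ih

end Exp

namespace BExp

theorem subst_subst (σ : X → Exp L Y) (σ' : Y → Exp L Z) (b : BExp L X) :
    (b.subst σ).subst σ' = b.subst fun x => (σ x).subst σ' := by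
  induction b <;> simp_all only [subst, Exp.subst_subst]

theorem subst_congr {σ σ' : X → Exp L Y} {b : BExp L X} (h : ∀ x ∈ b.fv, σ x = σ' x) :
    b.subst σ = b.subst σ' := by
  induction b with
  | tt => rfl
  | ff => rfl
  | neg b ih => exact congrArg neg (ih h)
  | and b c ihb ihc =>
    exact congrArg₂ and (ihb fun x hx => h x (Or.inl hx)) (ihc fun x hx => h x (Or.inr hx))
  | or b c ihb ihc =>
    exact congrArg₂ or (ihb fun x hx => h x (Or.inl hx)) (ihc fun x hx => h x (Or.inr hx))
  | imp b c ihb ihc =>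
    exact congrArg₂ imp (ihb fun x hx => h x (Or.inl hx)) (ihc fun x hx => h x (Or.inr hx))
  | cmp r e e' =>
    exact congrArg₂ (cmp r) (Exp.subst_congr fun x hx => h x (Or.inl hx))
      (Exp.subst_congr fun x hx => h x (Or.inr hx))
  | pred p e =>
    exact congrArg (pred p) (funext fun i =>
      Exp.subst_congr fun x hx => h x (Set.mem_iUnion.2 ⟨i, hx⟩))

theorem subst_var (b : BExp L X) : b.subst Exp.var = b := by
  induction b <;> simp_all only [subst, Exp.subst_var]

theorem mem_fv_subst {σ : X → Exp L Y} {b : BExp L X} {y : Y} :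
    y ∈ (b.subst σ).fv ↔ ∃ x ∈ b.fv, y ∈ (σ x).fv := by
  induction b with
  | tt => simp [subst, fv]
  | ff => simp [subst, fv]
  | neg b ih => exact ih
  | pred p e =>
    simp only [subst, fv, Set.mem_iUnion, Exp.mem_fv_subst]
    exact ⟨fun ⟨i, x, h, h'⟩ => ⟨x, ⟨i, h⟩, h'⟩, fun ⟨x, ⟨i, h⟩, h'⟩ => ⟨i, x, h, h'⟩⟩
  | _ => simp_all only [subst, fv, Set.mem_union, Exp.mem_fv_subst, or_and_right, exists_or]

theorem holds_subst {σ : X → Exp L Y} {ψ : Y → ℝ} {b : BExp L X} :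
    (b.subst σ).holds ψ ↔ b.holds fun x => (σ x).eval ψ := by
  induction b <;> simp_all only [subst, holds, Exp.eval_subst]

theorem finite_fv (b : BExp L X) : b.fv.Finite := by
  induction b with
  | tt => exact Set.finite_empty
  | ff => exact Set.finite_empty
  | neg b ih => exact ih
  | pred p e => exact Set.finite_iUnion fun i => (e i).finite_fv
  | cmp r e e' => exact e.finite_fv.union e'.finite_fv
  | _ _ _ ih ih' => exact ih.union ih'

end BExp

namespace Tm

theorem liftSubst_var : subst.liftSubst (L := L) (Exp.var : X → Exp L X) = Exp.var := by
  funext o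
  cases o <;> rfl

theorem liftSubst_subst (σ : X → Exp L Y) (σ' : Y → Exp L Z) :
    (fun o => (subst.liftSubst σ o).subst (subst.liftSubst σ')) =
      subst.liftSubst fun x => (σ x).subst σ' := by
  funext o
  cases o with
  | none => rfl
  | some x =>
    simp only [subst.liftSubst, Exp.subst_subst]
    rfl

/-- The target types are generalized in the induction because passing under a binder replaces them
by their `Option` types, with lifted substitutions and mapped qubit renamings. -/
theorem subst_subst (σ : X → Exp L Y) (ρ : Q → R) (σ' : Y → Exp L Z) (ρ' : R → T) (t : Tm L X Q) :
    (t.subst σ ρ).subst σ' ρ' = t.subst (fun x => (σ x).subst σ') (ρ' ∘ ρ) := by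
  induction t generalizing Y R Z T <;>
    simp_all only [subst, Exp.subst_subst, BExp.subst_subst, liftSubst_subst, Option.map_comp_map,
      Function.comp_apply, Function.comp_assoc]

theorem liftSubst_congr {σ σ' : X → Exp L Y} {s : Set (Option X)}
    (h : ∀ x, some x ∈ s → σ x = σ' x) : ∀ o ∈ s, subst.liftSubst σ o = subst.liftSubst σ' o
  | none, _ => rfl
  | some x, hx => by simp only [subst.liftSubst, h x hx]

theorem subst_congr {σ σ' : X → Exp L Y} {ρ : Q → R} {t : Tm L X Q}
    (h : ∀ x ∈ t.fv, σ x = σ' x) : t.subst σ ρ = t.subst σ' ρ := by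
  induction t generalizing Y R with
  | nil => rfl
  | call A e q =>
    simp only [subst]
    congr 1
    exact funext fun i => Exp.subst_congr fun x hx => h x (Set.mem_iUnion.2 ⟨i, hx⟩)
  | tau t ih => exact congrArg tau (ih h)
  | inp c t ih => exact congrArg (inp c) (ih (liftSubst_congr h))
  | out c e t ih =>
    exact congrArg₂ (out c) (Exp.subst_congr fun x hx => h x (Or.inl hx))
      (ih fun x hx => h x (Or.inr hx))
  | qinp c t ih => exact congrArg (qinp c) (ih h)
  | qout c q t ih => exact congrArg (qout c _) (ih h)
  | oper F q t ih => exact congrArg (oper F _) (ih h)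
  | meas M q t ih => exact congrArg (meas M _) (ih (liftSubst_congr h))
  | sum t u iht ihu =>
    exact congrArg₂ sum (iht fun x hx => h x (Or.inl hx)) (ihu fun x hx => h x (Or.inr hx))
  | par t u iht ihu =>
    exact congrArg₂ par (iht fun x hx => h x (Or.inl hx)) (ihu fun x hx => h x (Or.inr hx))
  | res t C ih => exact congrArg (res · C) (ih h)
  | rel t f g ih => exact congrArg (rel · f g) (ih h)
  | cond b t ih =>
    exact congrArg₂ cond (BExp.subst_congr fun x hx => h x (Or.inl hx))
      (ih fun x hx => h x (Or.inr hx))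

theorem subst_var (t : Tm L X Q) : t.subst Exp.var id = t := by
  induction t <;>
    simp_all only [subst, Exp.subst_var, BExp.subst_var, liftSubst_var, Option.map_id,
      Function.id_comp, id]

theorem mem_fv_liftSubst {σ : X → Exp L Y} {s : Set (Option X)} {y : Y} :
    (∃ o ∈ s, some y ∈ (subst.liftSubst σ o).fv) ↔ ∃ x, some x ∈ s ∧ y ∈ (σ x).fv := by
  simp [Option.exists, subst.liftSubst, Exp.fv, Exp.mem_fv_subst]

theorem mem_fv_subst {σ : X → Exp L Y} {ρ : Q → R} {t : Tm L X Q} {y : Y} :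
    y ∈ (t.subst σ ρ).fv ↔ ∃ x ∈ t.fv, y ∈ (σ x).fv := by
  induction t generalizing Y R with
  | nil => simp [subst, fv]
  | call A e q =>
    simp only [subst, fv, Set.mem_iUnion, Exp.mem_fv_subst]
    exact ⟨fun ⟨i, x, h, h'⟩ => ⟨x, ⟨i, h⟩, h'⟩, fun ⟨x, ⟨i, h⟩, h'⟩ => ⟨i, x, h, h'⟩⟩
  | inp c t ih => simp only [subst, fv, Set.mem_ofPred_eq, ih, mem_fv_liftSubst]
  | meas M q t ih => simp only [subst, fv, Set.mem_ofPred_eq, ih, mem_fv_liftSubst]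
  | _ => simp_all only [subst, fv, Set.mem_union, Exp.mem_fv_subst, BExp.mem_fv_subst,
      or_and_right, exists_or]

theorem qv_subst_id {σ : X → Exp L Y} {t : Tm L X Q} : (t.subst σ id).qv = t.qv := by
  induction t generalizing Y <;>
    simp_all only [subst, qv, Option.map_id, Function.id_comp, id]

/-- Leaving the qubits fixed is what preserves well-formedness: a non-injective qubit map could
identify entries of a tuple or make parallel components share a qubit. -/
theorem WF.subst_id {σ : X → Exp L Y} {t : Tm L X Q} (h : t.WF) : (t.subst σ id).WF := by
  induction t generalizing Y <;>
    simp_all only [subst, WF, qv_subst_id, Option.map_id, Function.id_comp, id, not_false_eq_true,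
      and_self]

theorem finite_fv (t : Tm L X Q) : t.fv.Finite := by
  induction t with
  | nil => exact Set.finite_empty
  | call A e q => exact Set.finite_iUnion fun i => (e i).finite_fv
  | inp c t ih => exact ih.preimage (Option.some_injective _).injOn
  | meas M q t ih => exact ih.preimage (Option.some_injective _).injOn
  | out c e t ih => exact e.finite_fv.union ih
  | cond b t ih => exact b.finite_fv.union ih
  | sum t u iht ihu => exact iht.union ihu
  | par t u iht ihu => exact iht.union ihu
  | _ => assumption

end Tm

/-! ## Renaming of classical variables -/

open Equiv (Perm)

/-- A permutation of the classical variables as a substitution. -/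
def ren (π : Perm ℕ) (x : ℕ) : Exp L ℕ := Exp.var (π x)

theorem ren_one : (ren 1 : ℕ → Exp L ℕ) = Exp.var := rfl

theorem ren_subst (π π' : Perm ℕ) :
    (fun x => (ren π x : Exp L ℕ).subst (ren π')) = ren (π' * π) := rfl

theorem eval_ren (π : Perm ℕ) (ψ : ℕ → ℝ) : (fun x => (ren π x : Exp L ℕ).eval ψ) = ψ ∘ π := rfl

/-- The renaming of an expression. -/
def Exp.rename (π : Perm ℕ) (e : Exp L ℕ) : Exp L ℕ := e.subst (ren π)

namespace BExp

/-- The renaming of a boolean expression. -/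
def rename (π : Perm ℕ) (b : BExp L ℕ) : BExp L ℕ := b.subst (ren π)

theorem rename_rename (π π' : Perm ℕ) (b : BExp L ℕ) :
    (b.rename π).rename π' = b.rename (π' * π) := by
  rw [rename, rename, subst_subst, ren_subst, rename]

theorem rename_one (b : BExp L ℕ) : b.rename 1 = b := b.subst_var

theorem rename_inv (π : Perm ℕ) (b : BExp L ℕ) : (b.rename π⁻¹).rename π = b := by
  rw [rename_rename, mul_inv_cancel, rename_one]

theorem rename_eq_self {π : Perm ℕ} {b : BExp L ℕ} (h : ∀ x ∈ b.fv, π x = x) :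
    b.rename π = b :=
  (subst_congr fun x hx => congrArg Exp.var (h x hx)).trans b.subst_var

theorem holds_rename {π : Perm ℕ} {b : BExp L ℕ} {ψ : ℕ → ℝ} :
    (b.rename π).holds ψ ↔ b.holds (ψ ∘ π) := by
  rw [rename, holds_subst, eval_ren]

theorem Entails.rename {b c : BExp L ℕ} (h : b.Entails c) (π : Perm ℕ) :
    (b.rename π).Entails (c.rename π) :=
  fun _ hψ => holds_rename.2 (h _ (holds_rename.1 hψ))

end BExp

namespace Tm

/-- The renaming of the free classical variables of a term. -/
def rename (π : Perm ℕ) (t : Tm L ℕ Q) : Tm L ℕ Q := t.subst (ren π) id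

theorem rename_rename (π π' : Perm ℕ) (t : Tm L ℕ Q) :
    (t.rename π).rename π' = t.rename (π' * π) := by
  rw [rename, rename, subst_subst, ren_subst, rename, Function.id_comp]

theorem rename_one (t : Tm L ℕ Q) : t.rename 1 = t := t.subst_var

theorem rename_eq_self {π : Perm ℕ} {t : Tm L ℕ Q} (h : ∀ x ∈ t.fv, π x = x) : t.rename π = t :=
  (subst_congr fun x hx => congrArg Exp.var (h x hx)).trans t.subst_var

theorem mem_fv_rename {π : Perm ℕ} {t : Tm L ℕ Q} {x : ℕ} : π x ∈ (t.rename π).fv ↔ x ∈ t.fv := by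
  simp [rename, mem_fv_subst, ren, Exp.fv]

theorem qv_rename {π : Perm ℕ} {t : Tm L ℕ Q} : (t.rename π).qv = t.qv := qv_subst_id

theorem rename_inst (π : Perm ℕ) (t : Tm L (Option ℕ) ℕ) (e : Exp L ℕ) :
    (t.inst e).rename π = (t.subst (subst.liftSubst (ren π)) id).inst (e.rename π) := by
  rw [inst, rename, inst, subst_subst, subst_subst]
  congr 1
  funext o
  cases o <;> rfl

/-- Classical and quantum substitution act on different kinds of variables, so they commute; the
received qubit needs no renaming. -/
theorem rename_instQ (π : Perm ℕ) (t : Tm L ℕ (Option ℕ)) (r : ℕ) :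
    (t.instQ r).rename π = (t.rename π).instQ r := by
  rw [instQ, rename, instQ, rename, subst_subst, subst_subst]
  rfl

/-- Injectivity of `π` is essential: a variable other than `x` must not become `π x` before the
replacement takes place. -/
theorem rename_replace (π : Perm ℕ) (t : Tm L ℕ ℕ) (x : ℕ) (e : Exp L ℕ) :
    (t.replace x e).rename π = (t.rename π).replace (π x) (e.rename π) := by
  rw [replace, rename, replace, rename, subst_subst, subst_subst]
  congr 1
  funext y
  by_cases h : y = x
  · simp [h, ren, Exp.subst, Exp.rename]
  · simp [h, ren, Exp.subst]

/-- Renaming reaches only the substituted expressions. For the body of a process constant this means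
that only the actual arguments change, since its free variables are all parameters. -/
theorem rename_subst (π : Perm ℕ) (σ : X → Exp L ℕ) (ρ : R → Q) (t : Tm L X R) :
    (t.subst σ ρ).rename π = t.subst (fun x => (σ x).rename π) ρ := by
  rw [rename, subst_subst]
  rfl

end Tm

namespace Act

/-- The renaming of an action. -/
def rename (π : Perm ℕ) : Act L → Act L
  | tau => tau
  | inp c x => inp c (π x)
  | out c e => out c (e.rename π)
  | qinp c r => qinp c r
  | qout c r => qout c r

theorem rename_inv (π : Perm ℕ) (γ : Act L) : (γ.rename π⁻¹).rename π = γ := by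
  cases γ <;> simp [rename]
  rw [Exp.rename, Exp.rename, Exp.subst_subst, ren_subst, mul_inv_cancel, ren_one, Exp.subst_var]

theorem mem_bv_rename {π : Perm ℕ} {γ : Act L} {x : ℕ} : π x ∈ (γ.rename π).bv ↔ x ∈ γ.bv := by
  cases γ <;> simp [rename, bv]

theorem qbv_rename {π : Perm ℕ} {γ : Act L} : (γ.rename π).qbv = γ.qbv := by
  cases γ <;> rfl

theorem cn_rename {π : Perm ℕ} {γ : Act L} : (γ.rename π).cn = γ.cn := by
  cases γ <;> rfl

theorem rename_relabel (π : Perm ℕ) (f : L.CChan ↪ L.CChan) (g : L.QChan ↪ L.QChan) (γ : Act L) :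
    (γ.relabel f g).rename π = (γ.rename π).relabel f g := by
  cases γ <;> rfl

theorem disjoint_bv_rename {π : Perm ℕ} {γ : Act L} {V W : Set ℕ} (h : Disjoint γ.bv V)
    (hW : ∀ x, π x ∈ W → x ∈ V) : Disjoint (γ.rename π).bv W := by
  rw [Set.disjoint_left] at h ⊢
  intro y hy hyW
  obtain ⟨x, rfl⟩ := π.surjective y
  exact h (mem_bv_rename.1 hy) (hW x hyW)

namespace EqUnder

/-- Classical outputs, excluded from the constructor `refl`, are covered by `out` with two identical
expressions. -/
theorem refl' (b : BExp L ℕ) (γ : Act L) : EqUnder b γ γ := by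
  by_cases h : ∀ c e, γ ≠ Act.out c e
  · exact refl γ h
  · push Not at h
    obtain ⟨c, e, rfl⟩ := h
    exact out c e e fun _ _ => rfl

/-- This carries the freshness of a bound variable from a move to its answer, and so along a chain.
-/
theorem bv_eq {b : BExp L ℕ} {γ γ' : Act L} (h : EqUnder b γ γ') : γ'.bv = γ.bv := by
  cases h <;> rfl

theorem mono {b c : BExp L ℕ} (hc : c.Entails b) {γ γ' : Act L} (h : EqUnder b γ γ') :
    EqUnder c γ γ' := by
  cases h with
  | out a e e' h => exact out a e e' fun _ hψ => h _ (hc _ hψ)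
  | refl _ h => exact refl _ h

theorem trans {b : BExp L ℕ} {γ γ' γ'' : Act L} (h : EqUnder b γ γ') (h' : EqUnder b γ' γ'') :
    EqUnder b γ γ'' := by
  cases h with
  | refl _ h => exact h'
  | out a e e' h =>
    cases h' with
    | refl _ hn => exact absurd rfl (hn a e')
    | out _ _ e'' h' => exact out a e e'' fun ψ hψ => Eq.trans (h ψ hψ) (h' ψ hψ)

theorem rename {b : BExp L ℕ} {γ γ' : Act L} (h : EqUnder b γ γ') (π : Perm ℕ) :
    EqUnder (b.rename π) (γ.rename π) (γ'.rename π) := by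
  cases h with
  | refl _ h => exact refl' _ _
  | out a e e' h => exact out a _ _ (h.rename π)

end EqUnder

/-- The bound variable of an action can be renamed to avoid a finite set. -/
theorem exists_fresh (γ : Act L) {V W : Set ℕ} (hV : V.Finite) (hW : W.Finite)
    (h : Disjoint γ.bv V) :
    ∃ π : Perm ℕ, (∀ x ∈ V, π x = x) ∧ Disjoint (γ.rename π).bv W := by
  cases γ with
  | inp c x =>
    obtain ⟨y, hy⟩ := (hV.union hW).exists_notMem
    rw [Set.mem_union, not_or] at hy
    -- Neither `x` nor the new name `y` lies in `V`, so the transposition fixes `V` pointwise.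
    refine ⟨Equiv.swap x y, fun z hz => Equiv.swap_apply_of_ne_of_ne ?_ ?_, ?_⟩
    · rintro rfl
      exact Set.disjoint_left.1 h rfl hz
    · rintro rfl
      exact hy.1 hz
    · simpa [rename, bv] using hy.2
  | _ => exact ⟨1, fun _ _ => rfl, by simp [rename, bv]⟩

end Act

/-! ## Renaming of transitions -/

/-- The renaming of a raw snapshot. -/
def RawSnap.rename (π : Perm ℕ) (s : RawSnap L) : RawSnap L := (s.1.rename π, s.2)

theorem mapDomain_rename_single (π : Perm ℕ) (t : Tm L ℕ ℕ) (E : CPt ℕ) (A : CP ℕ) :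
    (Finsupp.single (t, E) A).mapDomain (RawSnap.rename π) = Finsupp.single (t.rename π, E) A :=
  Finsupp.mapDomain_single

-- The transition rules mention classical variables only through substitution and freshness, and
-- both are preserved by a bijective renaming. The super-operators and the qubits are untouched.
set_option maxHeartbeats 1000000 in
theorem RawStep.rename {D : Defs L} {s : RawSnap L} {b : BExp L ℕ} {γ : Act L}
    {Δ : RawSnap L →₀ CP ℕ} (h : RawStep D s b γ Δ) (π : Perm ℕ) :
    RawStep D (s.rename π) (b.rename π) (γ.rename π) (Δ.mapDomain (RawSnap.rename π)) := by
  have disj : ∀ {γ : Act L} {u : Tm L ℕ ℕ}, Disjoint γ.bv u.fv →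
      Disjoint (γ.rename π).bv (u.rename π).fv := fun h =>
    Act.disjoint_bv_rename h fun _ => Tm.mem_fv_rename.1
  have qdisj : ∀ {γ : Act L} {u : Tm L ℕ ℕ}, Disjoint γ.qbv u.qv →
      Disjoint (γ.rename π).qbv (u.rename π).qv := fun h => by
    rwa [Act.qbv_rename, Tm.qv_rename]
  induction h with
  | tau t E => rw [mapDomain_rename_single]; exact .tau _ E
  | inp c t E x hx =>
    rw [mapDomain_rename_single, Tm.rename_inst]
    -- The renamed move receives into `π x`, which is fresh for the renamed scope because `x` was
    -- fresh for the original one.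
    exact .inp c _ E (π x) fun h => hx (Tm.mem_fv_rename.1 h)
  | out c e t E => rw [mapDomain_rename_single]; exact .out c _ _ E
  | qinp c t E r hr =>
    rw [mapDomain_rename_single, Tm.rename_instQ]
    have : (Tm.qinp c t).rename π = Tm.qinp c (t.rename π) := by
      simp only [Tm.rename, Tm.subst, Option.map_id]
    simp only [RawSnap.rename, this]
    refine .qinp c _ E r ?_
    rw [← this, Tm.qv_rename]
    exact hr
  | qout c q t E => rw [mapDomain_rename_single]; exact .qout c q _ E
  | oper F q t E => rw [mapDomain_rename_single]; exact .oper F q _ E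
  | meas M q t E φ l hM =>
    rw [Finsupp.mapDomain_finsetSum]
    simp only [mapDomain_rename_single, Tm.rename_inst]
    exact .meas M q _ E φ l hM
  | sumL u h ih => exact .sumL _ ih
  | sumR t h ih => exact .sumR _ ih
  | parL u h hc hq ih =>
    have := RawStep.parL (D := D) (u.rename π) ih (disj hc) (qdisj hq)
    rw [← Finsupp.mapDomain_comp] at this ⊢
    exact this
  | parR t h hc hq ih =>
    have := RawStep.parR (t.rename π) ih (disj hc) (qdisj hq)
    rw [← Finsupp.mapDomain_comp] at this ⊢
    exact this
  | comL h₁ h₂ ih₁ ih₂ =>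
    rw [mapDomain_rename_single] at ih₁ ih₂ ⊢
    -- Restating the hypotheses unfolds the renamed labels, by definitional equality, into the form
    -- required by the communication rule.
    have ih₁ : RawStep D _ _ (Act.inp _ (π _)) _ := ih₁
    have ih₂ : RawStep D _ _ (Act.out _ (Exp.rename π _)) _ := ih₂
    have := RawStep.comL ih₁ ih₂
    rwa [← Tm.rename_replace] at this
  | comR h₁ h₂ ih₁ ih₂ =>
    rw [mapDomain_rename_single] at ih₁ ih₂ ⊢
    have ih₁ : RawStep D _ _ (Act.out _ (Exp.rename π _)) _ := ih₁
    have ih₂ : RawStep D _ _ (Act.inp _ (π _)) _ := ih₂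
    have := RawStep.comR ih₁ ih₂
    rwa [← Tm.rename_replace] at this
  | qcomL h₁ h₂ ih₁ ih₂ =>
    rw [mapDomain_rename_single] at ih₁ ih₂ ⊢
    have ih₁ : RawStep D _ _ (Act.qinp _ _) _ := ih₁
    have ih₂ : RawStep D _ _ (Act.qout _ _) _ := ih₂
    exact RawStep.qcomL ih₁ ih₂
  | qcomR h₁ h₂ ih₁ ih₂ =>
    rw [mapDomain_rename_single] at ih₁ ih₂ ⊢
    have ih₁ : RawStep D _ _ (Act.qout _ _) _ := ih₁
    have ih₂ : RawStep D _ _ (Act.qinp _ _) _ := ih₂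
    exact RawStep.qcomR ih₁ ih₂
  | res C h hC ih =>
    have := RawStep.res C ih (by rwa [Act.cn_rename])
    rw [← Finsupp.mapDomain_comp] at this ⊢
    exact this
  | rel f g h ih =>
    have := RawStep.rel f g ih
    rw [← Act.rename_relabel, ← Finsupp.mapDomain_comp] at this
    rw [← Finsupp.mapDomain_comp]
    exact this
  | cond b h ih => exact .cond _ ih
  | call h ih =>
    refine .call ?_
    simp only [RawSnap.rename, Tm.rename_subst] at ih
    exact ih

variable {D : Defs L}

/-! ## Lifting of relations to distributions -/

/-- The additive map `A ↦ tr A(ρ)` on super-operators. -/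
def traceAt (ρ : TraceClass ℕ) : CP ℕ →+ ℂ where
  toFun A := tr (A.1 ρ).1
  map_zero' := by simp [tr]
  map_add' A B := by
    have hA := (summable_tr (A.1 ρ).2).hasSum
    have hB := (summable_tr (B.1 ρ).2).hasSum
    have h := (hA.add hB).tsum_eq
    simp only [← inner_add_right] at h
    exact h

/-- The space of no qubits is one-dimensional, so each partial trace is the full trace times the
identity. The two Löwner inequalities combine to equality by antisymmetry. -/
theorem eqsim_iff {A B : CP ℕ} :
    Eqsim A B ↔ ∀ ρ : TraceClass ℕ, IsDensity ρ → traceAt ρ A = traceAt ρ B := by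
  have : IsEmpty {i : ℕ // i ∈ (∅ : Set ℕ)} := ⟨fun i => i.2⟩
  simp only [Eqsim, EqsimOn, LesssimOn, partialTrace_of_isEmpty, ← forall_and, ← le_antisymm_iff]
  refine forall₂_congr fun ρ _ => ⟨fun h => ?_, fun h => congrArg (· • _) h⟩
  -- The scalar is recovered as the only matrix entry, at the basis state of the empty system.
  have h' := congrArg (fun A : Op {i : ℕ // i ∈ (∅ : Set ℕ)} => A (ket ∅) ∅) h
  classical
  simp only [smul_apply, one_apply_eq_self, lp.coeFn_smul, Pi.smul_apply, ket_apply, if_true,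
    smul_eq_mul, mul_one] at h'
  exact h'

namespace SODist

variable {S S' : Type 1}

/-- The image of a distribution. -/
def map (f : S → S') (Δ : SODist S) : SODist S' :=
  ⟨Δ.1.mapDomain f, by
    rw [Finsupp.sum_mapDomain_index (fun _ => rfl) (fun _ _ _ => rfl)]
    exact Δ.2⟩

theorem map_id (Δ : SODist S) : Δ.map id = Δ := Subtype.ext Finsupp.mapDomain_id

theorem map_map {S'' : Type 1} (f : S → S') (g : S' → S'') (Δ : SODist S) :
    (Δ.map f).map g = Δ.map (g ∘ f) := Subtype.ext Finsupp.mapDomain_comp.symm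

theorem map_comp (f : S → S') (Δ : SODist S) (E : CPt ℕ) :
    (Δ.comp E).map f = (Δ.map f).comp E :=
  Subtype.ext (Finsupp.mapDomain_mapRange f Δ.1 (fun A => A * (E : CP ℕ)) (zero_mul _) fun _ _ => add_mul _ _ _)

/-- The distribution of the traces of the results for the state `ρ`. -/
def traces (ρ : TraceClass ℕ) (Δ : SODist S) : S →₀ ℂ := Δ.1.mapRange (traceAt ρ) (map_zero _)

theorem traces_map (ρ : TraceClass ℕ) (f : S → S') (Δ : SODist S) :
    (Δ.map f).traces ρ = (Δ.traces ρ).mapDomain f :=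
  (Finsupp.mapDomain_mapRange f Δ.1 _ _ fun _ _ => map_add _ _ _).symm

/-- The mass of an equivalence class is a coefficient of the push-forward to the quotient. This
turns the lifting into an equality of finitely supported functions, to which functoriality of
`Finsupp.mapDomain` applies. -/
theorem traceAt_mass (ρ : TraceClass ℕ) (R : Setoid S) (Δ : SODist S) (s : S) :
    traceAt ρ (Δ.mass {s' | R s s'}) = (Δ.traces ρ).mapDomain (Quotient.mk R) (Quotient.mk R s) := by
  classical
  rw [mass, Finsupp.sum, map_sum, traces, Finsupp.mapDomain, Finsupp.sum_apply,
    Finsupp.sum_mapRange_index (fun _ => by simp), Finsupp.sum]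
  refine Finset.sum_congr rfl fun s' _ => ?_
  rw [Finsupp.single_apply]
  have : s' ∈ {s' | R s s'} ↔ Quotient.mk R s' = Quotient.mk R s :=
    R.comm'.trans Quotient.eq.symm
  by_cases h : s' ∈ {s' | R s s'}
  · rw [if_pos h, if_pos (this.1 h)]
  · rw [if_neg h, if_neg (mt this.2 h), map_zero]

end SODist

theorem lift_iff {S : Type 1} (R : Setoid S) {Δ Ξ : SODist S} :
    Lift R Δ Ξ ↔ ∀ ρ : TraceClass ℕ, IsDensity ρ →
      (Δ.traces ρ).mapDomain (Quotient.mk R) = (Ξ.traces ρ).mapDomain (Quotient.mk R) := by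
  simp only [Lift, eqsim_iff, SODist.traceAt_mass]
  exact ⟨fun h ρ hρ => Finsupp.ext fun q => Quotient.inductionOn q fun s => h s ρ hρ,
    fun h s ρ hρ => DFunLike.congr_fun (h ρ hρ) _⟩

/-- The map `f` descends to the quotients, and equal push-forwards stay equal under the induced map.
It need not be injective; it may merge classes. -/
theorem Lift.map {S S' : Type 1} {R : S → S → Prop} {R' : S' → S' → Prop} (hR : Equivalence R)
    (hR' : Equivalence R') {f : S → S'} (hf : ∀ s t, R s t → R' (f s) (f t)) {Δ Ξ : SODist S}
    (h : Lift R Δ Ξ) : Lift R' (Δ.map f) (Ξ.map f) := by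
  refine (lift_iff ⟨R', hR'⟩).2 ?_
  replace h := (lift_iff ⟨R, hR⟩).1 h
  intro ρ hρ
  have h' := congrArg (Finsupp.mapDomain
    (Quotient.map (sa := ⟨R, hR⟩) (sb := ⟨R', hR'⟩) f fun _ _ => hf _ _)) (h ρ hρ)
  simp only [SODist.traces_map, ← Finsupp.mapDomain_comp] at h' ⊢
  exact h'

/-- Classes of the coarser relation are unions of classes of the finer one. Both relations must be
equivalences, which is why that hypothesis recurs below. -/
theorem Lift.mono {S : Type 1} {R R' : S → S → Prop} (hR : Equivalence R) (hR' : Equivalence R')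
    (hRR' : ∀ s t, R s t → R' s t) {Δ Ξ : SODist S} (h : Lift R Δ Ξ) : Lift R' Δ Ξ := by
  simpa only [SODist.map_id] using h.map hR hR' (f := id) hRR'

theorem Lift.refl {S : Type 1} (R : S → S → Prop) (Δ : SODist S) : Lift R Δ Δ :=
  fun _ => eqsim_iff.2 fun _ _ => rfl

theorem Lift.trans {S : Type 1} {R : S → S → Prop} {Δ Ξ Θ : SODist S} (h : Lift R Δ Ξ)
    (h' : Lift R Ξ Θ) : Lift R Δ Θ := fun s =>
  eqsim_iff.2 fun ρ hρ => (eqsim_iff.1 (h s) ρ hρ).trans (eqsim_iff.1 (h' s) ρ hρ)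

/-! ## Renaming of snapshots -/

namespace SN

/-- The renaming of the free classical variables of a snapshot. -/
def rename (π : Perm ℕ) (s : SN L) : SN L := (⟨s.1.1.rename π, s.1.2.subst_id⟩, s.2)

theorem rename_rename (π π' : Perm ℕ) (s : SN L) : (s.rename π).rename π' = s.rename (π' * π) :=
  Prod.ext (Subtype.ext (Tm.rename_rename π π' _)) rfl

theorem rename_one (s : SN L) : s.rename 1 = s := Prod.ext (Subtype.ext (Tm.rename_one _)) rfl

theorem rename_inv (π : Perm ℕ) (s : SN L) : (s.rename π⁻¹).rename π = s := by
  rw [rename_rename, mul_inv_cancel, rename_one]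

theorem inv_rename (π : Perm ℕ) (s : SN L) : (s.rename π).rename π⁻¹ = s := by
  rw [rename_rename, inv_mul_cancel, rename_one]

theorem rename_eq_self {π : Perm ℕ} {s : SN L} (h : ∀ x ∈ s.fv, π x = x) : s.rename π = s :=
  Prod.ext (Subtype.ext (Tm.rename_eq_self h)) rfl

theorem qv_rename {π : Perm ℕ} {s : SN L} : (s.rename π).qv = s.qv := Tm.qv_rename

theorem finite_fv (s : SN L) : s.fv.Finite := s.1.1.finite_fv

end SN

theorem SODist.rename_inv (π : Perm ℕ) (Δ : SODist (SN L)) :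
    (Δ.map (SN.rename π⁻¹)).map (SN.rename π) = Δ := by
  rw [map_map, show SN.rename π ∘ SN.rename π⁻¹ = id from funext (SN.rename_inv π), map_id]

theorem Step.rename {s : SN L} {b : BExp L ℕ} {γ : Act L} {Δ : SODist (SN L)}
    (h : Step D s b γ Δ) (π : Perm ℕ) :
    Step D (s.rename π) (b.rename π) (γ.rename π) (Δ.map (SN.rename π)) := by
  have h' := RawStep.rename h π
  rw [← Finsupp.mapDomain_comp] at h'
  rw [Step, SODist.map, ← Finsupp.mapDomain_comp]
  exact h'

/-! ## Matching of moves -/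

/-- The move of `s` (after `G`) with label `b₁, γ` and result `Δ` is matched by moves of `u`. -/
def Matches (D : Defs L) (S : BExp L ℕ → SN L → SN L → Prop) (b : BExp L ℕ) (s u : SN L)
    (G : CPt ℕ) (b₁ : BExp L ℕ) (γ : Act L) (Δ : SODist (SN L)) : Prop :=
  ∃ B : Set (BExp L ℕ), B.Finite ∧ (b.and b₁).EntailsDisj B ∧
    ∀ b' ∈ B, ∃ (b₂ : BExp L ℕ) (γ' : Act L) (Ξ : SODist (SN L)),
      b'.Entails b₂ ∧ Act.EqUnder b' γ γ' ∧ Step D (u.act G) b₂ γ' Ξ ∧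
      Lift (S b') (Δ.comp (G * s.2)) (Ξ.comp (G * u.2))

namespace Matches

variable {S S' : BExp L ℕ → SN L → SN L → Prop} {b : BExp L ℕ} {s u v : SN L} {G : CPt ℕ}
  {b₁ : BExp L ℕ} {γ : Act L} {Δ : SODist (SN L)}

theorem mono (hS : ∀ b, Equivalence (S b)) (hS' : ∀ b, Equivalence (S' b))
    (h : ∀ b s u, S b s u → S' b s u) (hm : Matches D S b s u G b₁ γ Δ) :
    Matches D S' b s u G b₁ γ Δ := by
  obtain ⟨B, hB, hbB, hm⟩ := hm
  refine ⟨B, hB, hbB, fun b' hb' => ?_⟩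
  obtain ⟨b₂, γ', Ξ, h₂, hγ, hs, hl⟩ := hm b' hb'
  exact ⟨b₂, γ', Ξ, h₂, hγ, hs, hl.mono (hS b') (hS' b') (h b')⟩

theorem strengthen {c : BExp L ℕ} (hc : b.Entails c) (hm : Matches D S c s u G b₁ γ Δ) :
    Matches D S b s u G b₁ γ Δ := by
  obtain ⟨B, hB, hbB, hm⟩ := hm
  exact ⟨B, hB, fun ψ hψ => hbB ψ ⟨hc ψ hψ.1, hψ.2⟩, hm⟩

/-- The empty disjunction suffices, so nothing has to be answered. -/
theorem of_not_satisfiable (hb : ¬ b.Satisfiable) : Matches D S b s u G b₁ γ Δ :=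
  ⟨∅, Set.finite_empty, fun ψ hψ => absurd ⟨ψ, hψ.1⟩ hb, fun _ h => h.elim⟩

theorem refl (h : Step D (s.act G) b₁ γ Δ) : Matches D S b s s G b₁ γ Δ := by
  refine ⟨{b₁}, Set.finite_singleton _, fun ψ hψ => ⟨b₁, rfl, hψ.2⟩, ?_⟩
  rintro _ rfl
  exact ⟨_, γ, Δ, fun _ h => h, Act.EqUnder.refl' _ _, h, Lift.refl _ _⟩

theorem rename (hS : ∀ b, Equivalence (S b)) (π : Perm ℕ)
    (h : ∀ b s u, S b s u → S (b.rename π) (s.rename π) (u.rename π))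
    (hm : Matches D S b s u G b₁ γ Δ) :
    Matches D S (b.rename π) (s.rename π) (u.rename π) G (b₁.rename π) (γ.rename π)
      (Δ.map (SN.rename π)) := by
  obtain ⟨B, hB, hbB, hm⟩ := hm
  refine ⟨BExp.rename π '' B, hB.image _, fun ψ hψ => ?_, ?_⟩
  · obtain ⟨b', hb', hψ'⟩ := hbB (ψ ∘ π) ⟨BExp.holds_rename.1 hψ.1, BExp.holds_rename.1 hψ.2⟩
    exact ⟨_, ⟨b', hb', rfl⟩, BExp.holds_rename.2 hψ'⟩
  · rintro _ ⟨b', hb', rfl⟩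
    obtain ⟨b₂, γ', Ξ, h₂, hγ, hs, hl⟩ := hm b' hb'
    refine ⟨_, _, _, h₂.rename π, hγ.rename π, hs.rename π, ?_⟩
    have := hl.map (hS b') (hS _) (h b')
    rwa [SODist.map_comp, SODist.map_comp] at this

/-- Each answer of `v` is answered in turn by `u`. The second matching is required under the
original `b`, not under the case condition `b'`, which may contain further variables; `b'` is
restored by conjunction. -/
theorem trans (hS : ∀ b c, b.Entails c → ∀ s u, S c s u → S b s u) (hE : ∀ b, Equivalence (S b))
    (h₁ : Matches D S b s v G b₁ γ Δ)
    (h₂ : ∀ b₂ γ' Ξ, γ'.bv = γ.bv → Step D (v.act G) b₂ γ' Ξ → Matches D S b v u G b₂ γ' Ξ) :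
    Matches D S b s u G b₁ γ Δ := by
  obtain ⟨B, hB, hbB, hm⟩ := h₁
  have key : ∀ b' ∈ B, ∃ C : Set (BExp L ℕ), C.Finite ∧ (b.and b').EntailsDisj C ∧
      ∀ c ∈ C, ∃ (b₂ : BExp L ℕ) (γ' : Act L) (Ξ : SODist (SN L)),
        c.Entails b₂ ∧ Act.EqUnder c γ γ' ∧ Step D (u.act G) b₂ γ' Ξ ∧
        Lift (S c) (Δ.comp (G * s.2)) (Ξ.comp (G * u.2)) := by
    intro b' hb'
    obtain ⟨b₂, γ', Ξ, hb₂, hγ, hs, hl⟩ := hm b' hb'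
    obtain ⟨C, hC, hbC, hm'⟩ := h₂ b₂ γ' Ξ hγ.bv_eq hs
    -- The cases are the conjunctions of `b'` with the members of `C`. Each entails both conditions,
    -- so closure of `S` under strengthening brings the two liftings to a common relation.
    refine ⟨BExp.and b' '' C, hC.image _, fun ψ hψ => ?_, ?_⟩
    · obtain ⟨c, hc, hψc⟩ := hbC ψ ⟨hψ.1, hb₂ ψ hψ.2⟩
      exact ⟨_, ⟨c, hc, rfl⟩, hψ.2, hψc⟩
    · rintro _ ⟨c, hc, rfl⟩
      obtain ⟨b₃, γ'', Θ, hb₃, hγ', hs', hl'⟩ := hm' c hc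
      have e₁ : (b'.and c).Entails b' := fun _ h => h.1
      have e₂ : (b'.and c).Entails c := fun _ h => h.2
      exact ⟨b₃, γ'', Θ, fun ψ hψ => hb₃ ψ hψ.2, (hγ.mono e₁).trans (hγ'.mono e₂), hs',
        (hl.mono (hE _) (hE _) (hS _ _ e₁)).trans (hl'.mono (hE _) (hE _) (hS _ _ e₂))⟩
  choose! C hC using key
  refine ⟨⋃ b' ∈ B, C b', hB.biUnion fun b' hb' => (hC b' hb').1, fun ψ hψ => ?_, fun c hc => ?_⟩
  · obtain ⟨b', hb', hψ'⟩ := hbB ψ hψ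
    obtain ⟨c, hc, hψc⟩ := (hC b' hb').2.1 ψ ⟨hψ.1, hψ'⟩
    exact ⟨c, Set.mem_biUnion hb' hc, hψc⟩
  · simp only [Set.mem_iUnion, exists_prop] at hc
    obtain ⟨b', hb', hc⟩ := hc
    exact (hC b' hb').2.2 c hc

end Matches

theorem Simulates.mono {S S' : BExp L ℕ → SN L → SN L → Prop} (hS : ∀ b, Equivalence (S b))
    (hS' : ∀ b, Equivalence (S' b)) (h : ∀ b s u, S b s u → S' b s u) {b : BExp L ℕ} {s u : SN L}
    (hs : Simulates D S b s u) : Simulates D S' b s u :=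
  fun G hG b₁ γ Δ hst hbv => Matches.mono hS hS' h (hs G hG b₁ γ Δ hst hbv)

/-! ## Bisimulations up to renaming, strengthening and equivalence -/

section UpTo

variable (P : BExp L ℕ → SN L → SN L → Prop)

/-- The closure of a family of relations under renaming and strengthening of the condition. -/
def RenameClosure (b : BExp L ℕ) (s u : SN L) : Prop :=
  ∃ (π : Perm ℕ) (c : BExp L ℕ) (s' u' : SN L), P c s' u' ∧ b.Entails (c.rename π) ∧
    s'.rename π = s ∧ u'.rename π = u

/-- The closure of a family of relations under renaming, strengthening of the condition, and
composition. -/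
def UpTo (b : BExp L ℕ) : SN L → SN L → Prop := Relation.ReflTransGen (RenameClosure P b)

variable {P}

theorem upTo_of {b : BExp L ℕ} {s u : SN L} (h : P b s u) : UpTo P b s u :=
  .single ⟨1, b, s, u, h, by rw [BExp.rename_one]; exact fun _ h => h, s.rename_one, u.rename_one⟩

/-- Symmetry of `P` suffices: reversing a link of a chain keeps its permutation and its condition.
-/
theorem equivalence_upTo (hP : ∀ b s u, P b s u → P b u s) (b : BExp L ℕ) :
    Equivalence (UpTo P b) where
  refl _ := .refl
  symm h := by
    have : Std.Symm (RenameClosure P b) := ⟨fun _ _ ⟨π, c, s', u', h, hc, hs, hu⟩ =>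
      ⟨π, c, u', s', hP _ _ _ h, hc, hu, hs⟩⟩
    exact symm_of (Relation.ReflTransGen (RenameClosure P b)) h
  trans := .trans

theorem UpTo.strengthen {b c : BExp L ℕ} (hbc : b.Entails c) {s u : SN L} (h : UpTo P c s u) :
    UpTo P b s u :=
  Relation.ReflTransGen.mono (r := RenameClosure P c) (fun _ _ ⟨π, d, s', u', h, hc, hs, hu⟩ =>
    ⟨π, d, s', u', h, fun ψ hψ => hc ψ (hbc ψ hψ), hs, hu⟩) _ _ h

theorem UpTo.rename (π : Perm ℕ) {b : BExp L ℕ} {s u : SN L} (h : UpTo P b s u) :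
    UpTo P (b.rename π) (s.rename π) (u.rename π) := by
  refine Relation.ReflTransGen.lift (r := RenameClosure P b) (SN.rename π) ?_ _ _ h
  rintro _ _ ⟨π', c, s', u', h, hc, rfl, rfl⟩
  refine ⟨π * π', c, s', u', h, ?_, (SN.rename_rename _ _ _).symm, (SN.rename_rename _ _ _).symm⟩
  rw [← BExp.rename_rename]
  exact hc.rename π

/-- `u` matches the moves of `s`, provided that their bound variables avoid a finite set. -/
def SimulatesFresh (D : Defs L) (S : BExp L ℕ → SN L → SN L → Prop) (b : BExp L ℕ)
    (s u : SN L) : Prop :=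
  ∃ W : Set ℕ, W.Finite ∧ ∀ G : CPt ℕ, ActsOn s.qvᶜ G → ∀ b₁ γ Δ,
    Step D (s.act G) b₁ γ Δ → Disjoint γ.bv W → Matches D S b s u G b₁ γ Δ

/-- The name of a bound variable is immaterial as long as it avoids the free variables of `b`, `s`
and `u`, so it can be moved out of the forbidden set `W` and back. -/
theorem SimulatesFresh.simulates (hP : ∀ b s u, P b s u → P b u s) {b : BExp L ℕ} {s u : SN L}
    (h : SimulatesFresh D (UpTo P) b s u) : Simulates D (UpTo P) b s u := by
  obtain ⟨W, hW, h⟩ := h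
  intro G hG b₁ γ Δ hs hbv
  obtain ⟨π, hπ, hγ⟩ := γ.exists_fresh ((b.finite_fv.union s.finite_fv).union u.finite_fv) hW
    (Set.disjoint_iff_inter_eq_empty.2 hbv)
  have hbπ : b.rename π = b := BExp.rename_eq_self fun x hx => hπ x (.inl (.inl hx))
  have hsπ : s.rename π = s := SN.rename_eq_self fun x hx => hπ x (.inl (.inr hx))
  have huπ : u.rename π = u := SN.rename_eq_self fun x hx => hπ x (.inr hx)
  have hstep := hs.rename π
  rw [show (s.act G).rename π = (s.rename π).act G from rfl, hsπ] at hstep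
  -- The answer to the renamed move is renamed back. The inverse of `π` also fixes `b`, `s` and `u`,
  -- so this answers the original move.
  have hm := (h G hG _ _ _ hstep hγ).rename (equivalence_upTo hP) π⁻¹ fun _ _ _ => UpTo.rename _
  have hb' : b.rename π⁻¹ = b := by
    conv_lhs => rw [← hbπ, BExp.rename_rename, inv_mul_cancel, BExp.rename_one]
  have hs' : s.rename π⁻¹ = s := by conv_lhs => rw [← hsπ, SN.inv_rename]
  have hu' : u.rename π⁻¹ = u := by conv_lhs => rw [← huπ, SN.inv_rename]
  have e₁ := BExp.rename_inv π⁻¹ b₁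
  have e₂ := Act.rename_inv π⁻¹ γ
  have e₃ := SODist.rename_inv π⁻¹ Δ
  rw [inv_inv] at e₁ e₂ e₃
  rwa [hb', hs', hu', e₁, e₂, e₃] at hm

theorem StaticCond.trans {b : BExp L ℕ} {s v u : SN L} (h : StaticCond b s v)
    (h' : StaticCond b v u) : StaticCond b s u := fun hb => by
  obtain ⟨hq, h₁, h₂⟩ := h hb
  obtain ⟨hq', h₁', h₂'⟩ := h' hb
  rw [← hq] at hq' h₁' h₂'
  exact ⟨hq', fun ρ hρ => (h₁ ρ hρ).trans (h₁' ρ hρ), fun ρ hρ => (h₂' ρ hρ).trans (h₂ ρ hρ)⟩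

/-- Induction along the chain, with `SimulatesFresh` as the invariant: the set to be avoided grows
by the renamed free variables of each link, which the endpoints need not contain. -/
theorem isSymbolicBisimulation_upTo (hP : ∀ b s u, P b s u → P b u s)
    (hP₁ : ∀ b s u, P b s u → StaticCond b s u)
    (hP₂ : ∀ b s u, P b s u → Simulates D (UpTo P) b s u) :
    IsSymbolicBisimulation D (UpTo P) := by
  have hE := equivalence_upTo hP
  refine ⟨hE, fun b s u h => ?_⟩
  suffices h : StaticCond b s u ∧ SimulatesFresh D (UpTo P) b s u from ⟨h.1, h.2.simulates hP⟩
  induction h with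
  | refl =>
    exact ⟨fun _ => ⟨rfl, fun _ _ => le_rfl, fun _ _ => le_rfl⟩,
      ∅, Set.finite_empty, fun _ _ _ _ _ hs _ => .refl hs⟩
  | @tail v u _ hvu ih =>
    obtain ⟨hst, W, hW, hsim⟩ := ih
    obtain ⟨π, c, v', u', h, hc, rfl, rfl⟩ := hvu
    have hst' : StaticCond b (v'.rename π) (u'.rename π) := by
      rintro ⟨ψ, hψ⟩
      obtain ⟨hq, h⟩ := hP₁ _ _ _ h ⟨_, BExp.holds_rename.1 (hc ψ hψ)⟩
      rw [SN.qv_rename, SN.qv_rename]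
      exact ⟨hq, h⟩
    refine ⟨hst.trans hst', W ∪ ⇑π '' (c.fv ∪ v'.fv ∪ u'.fv), hW.union
      (((c.finite_fv.union v'.finite_fv).union u'.finite_fv).image _), ?_⟩
    intro G hG b₁ γ Δ hs hγ
    rw [Set.disjoint_union_right] at hγ
    -- Only for satisfiable `b` does the static condition equate the qubits of `s` and `v`, which
    -- allows `G` to be applied at the last link.
    by_cases hb : b.Satisfiable
    swap
    · exact .of_not_satisfiable hb
    refine (hsim G hG b₁ γ Δ hs hγ.1).trans (fun _ _ hbc _ _ => UpTo.strengthen hbc) hE ?_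
    intro b₂ γ' Ξ hγ' hs'
    have hG' : ActsOn v'.qvᶜ G := by rwa [(hst hb).1, SN.qv_rename] at hG
    -- The move is pulled back to the original pair in `P`, matched there, and the answer is pushed
    -- forward by `π`; the condition is then strengthened from the renamed `c` to `b`.
    have hstep := hs'.rename π⁻¹
    rw [show ((v'.rename π).act G).rename π⁻¹ = ((v'.rename π).rename π⁻¹).act G from rfl,
      SN.inv_rename] at hstep
    have hd : Disjoint (γ'.rename π⁻¹).bv (c.fv ∪ v'.fv ∪ u'.fv) := by
      refine Act.disjoint_bv_rename (V := π '' (c.fv ∪ v'.fv ∪ u'.fv)) ?_ fun x hx => ⟨_, hx, ?_⟩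
      · rw [hγ']
        exact hγ.2
      · simp
    have hm := Matches.rename hE π (fun _ _ _ => UpTo.rename π)
      (hP₂ _ _ _ h G hG' _ _ _ hstep (Set.disjoint_iff_inter_eq_empty.1 hd))
    rw [BExp.rename_inv, Act.rename_inv, SODist.rename_inv] at hm
    exact hm.strengthen hc

end UpTo

/-! ## Bisimilarity -/

theorem equivalence_bisimilar (D : Defs L) (b : BExp L ℕ) : Equivalence (Bisimilar D b) where
  refl s := by
    -- The closure of the empty family consists of the chains of length zero, that is, of equality.
    refine ⟨UpTo fun _ _ _ => False, isSymbolicBisimulation_upTo ?_ ?_ ?_, .refl⟩ <;>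
      exact fun _ _ _ h => h.elim
  symm := fun ⟨S, hS, h⟩ => ⟨S, hS, (hS.1 _).symm h⟩
  trans := by
    rintro s v u ⟨S, hS, h⟩ ⟨S', hS', h'⟩
    let P : BExp L ℕ → SN L → SN L → Prop := fun b s u => S b s u ∨ S' b s u
    have hP : ∀ b s u, P b s u → P b u s := fun b s u =>
      Or.imp (fun h => (hS.1 b).symm h) fun h => (hS'.1 b).symm h
    refine ⟨UpTo P, isSymbolicBisimulation_upTo hP ?_ ?_,
      (upTo_of (Or.inl h)).trans (upTo_of (Or.inr h'))⟩
    · rintro b s u (h | h)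
      · exact (hS.2 b s u h).1
      · exact (hS'.2 b s u h).1
    · rintro b s u (h | h)
      · exact (hS.2 b s u h).2.mono hS.1 (equivalence_upTo hP) fun _ _ _ h => upTo_of (Or.inl h)
      · exact (hS'.2 b s u h).2.mono hS'.1 (equivalence_upTo hP) fun _ _ _ h => upTo_of (Or.inr h)

/-- A witnessing bisimulation is contained in bisimilarity, so its matchings remain valid for the
coarser relation; monotonicity of the lifting uses that bisimilarity is an equivalence. -/
theorem isSymbolicBisimulation_bisimilar (D : Defs L) :
    IsSymbolicBisimulation D (Bisimilar D) :=
  ⟨equivalence_bisimilar D, fun b s u ⟨S, hS, h⟩ => ⟨(hS.2 b s u h).1,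
    (hS.2 b s u h).2.mono hS.1 (equivalence_bisimilar D) fun _ _ _ h => ⟨S, hS, h⟩⟩⟩

theorem StaticCond.symm {b : BExp L ℕ} {s u : SN L} (h : StaticCond b s u) : StaticCond b u s :=
  fun hb => by
    obtain ⟨hq, h⟩ := h hb
    rw [hq] at h
    exact ⟨hq.symm, h.symm⟩

theorem bisimilar_of_simulates {b : BExp L ℕ} {s u : SN L} (h : StaticCond b s u)
    (hsu : Simulates D (Bisimilar D) b s u) (hus : Simulates D (Bisimilar D) b u s) :
    Bisimilar D b s u := by
  -- The new pair is added only under the condition `b`, together with its converse for symmetry.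
  -- Since `P` contains bisimilarity, answers up to bisimilarity are answers up to `UpTo P`.
  let P : BExp L ℕ → SN L → SN L → Prop := fun c x y =>
    Bisimilar D c x y ∨ c = b ∧ (x = s ∧ y = u ∨ x = u ∧ y = s)
  have hP : ∀ c x y, P c x y → P c y x := fun c x y => Or.imp
    (fun h => (equivalence_bisimilar D c).symm h)
    (And.imp_right fun h => h.symm.imp And.symm And.symm)
  refine ⟨UpTo P, isSymbolicBisimulation_upTo hP ?_ ?_, upTo_of (Or.inr ⟨rfl, Or.inl ⟨rfl, rfl⟩⟩)⟩
  · rintro c x y (hxy | ⟨rfl, ⟨rfl, rfl⟩ | ⟨rfl, rfl⟩⟩)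
    · exact ((isSymbolicBisimulation_bisimilar D).2 c x y hxy).1
    · exact h
    · exact h.symm
  · intro c x y hxy
    refine Simulates.mono (equivalence_bisimilar D) (equivalence_upTo hP)
      (fun _ _ _ h => upTo_of (Or.inl h)) ?_
    obtain hxy | ⟨rfl, ⟨rfl, rfl⟩ | ⟨rfl, rfl⟩⟩ := hxy
    · exact ((isSymbolicBisimulation_bisimilar D).2 c x y hxy).2
    · exact hsu
    · exact hus

end

end QCCS

theorem mainTheorem4 (L : QCCS.Sig) (D : QCCS.Defs L) (b : QCCS.BExp L ℕ) (s u : QCCS.SN L) :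
    QCCS.Bisimilar D b s u ↔
      (b.Satisfiable → s.qv = u.qv ∧ QCCS.EqsimOn s.qvᶜ s.2.1 u.2.1) ∧
      QCCS.Simulates D (QCCS.Bisimilar D) b s u ∧
      QCCS.Simulates D (QCCS.Bisimilar D) b u s := by
  refine ⟨fun h => ?_, fun ⟨h, hsu, hus⟩ => QCCS.bisimilar_of_simulates h hsu hus⟩
  have H := QCCS.isSymbolicBisimulation_bisimilar D
  -- The third condition is the second one for the reversed pair.
  exact ⟨(H.2 b s u h).1, (H.2 b s u h).2, (H.2 b u s ((H.1 b).symm h)).2⟩
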